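/- Consider the fixed effects panel model $y_{it}=\alpha+x_{it}'\beta+\mu_i+\nu_{it}$, $1\le i\le n$, $1\le t\le T$, with regressors $x_{it}\in\mathbb R^k$, $k$ fixed, individual effects $\mu_i$ (arbitrary, possibly random) and $n=n(T)$ with $n/T\to c$ for some $0<c<\infty$ as $T\to\infty$. The arrays $(x_{it})$ and $(\nu_{it})$, $i,t\ge1$, live on one probability space. For an array $z$ put $\tilde z_{it}=z_{it}-\frac1T\sum_{s=1}^T z_{is}$, let $X_i=(\tilde x_{i1},\dots,\tilde x_{iT})$ ($k\times T$), $\hat\beta=\big(\sum_{i,t}\tilde x_{it}\tilde x_{it}'\big)^{-1}\sum_{i,t}\tilde x_{it}\tilde y_{it}$ and $\hat\nu_{it}=\tilde y_{it}-\tilde x_{it}'\hat\beta$. Let $$S_T=\frac1T\sum_{t=1}^T\tilde\nu_t\tilde\nu_t',\qquad \hat S_T=\frac1T\sum_{t=1}^T\hat\nu_t\hat\nu_t'\qquad(n\times n),$$ where $\tilde\nu_t=(\tilde\nu_{1t},\dots,\tilde\nu_{nt})'$ and $\hat\nu_t=(\hat\nu_{1t},\dots,\hat\nu_{nt})'$,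 and let $R_T=D_T^{-1/2}S_TD_T^{-1/2}$, $\hat R_T=\hat D_T^{-1/2}\hat S_T\hat D_T^{-1/2}$ with $D_T=\mathrm{diag}(S_T)$, $\hat D_T=\mathrm{diag}(\hat S_T)$ be the sample correlation matrices of the centred errors and of the OLS residuals. Assume: (B1) the error vectors $\nu_t=(\nu_{it})_i$, $t=1,2,\dots$, are i.i.d. with mean zero, and $\sup_{i,t}E|\nu_{it}|^6<\infty$; (H$_0$) the errors are independent across the units, i.e. the sequences $(\nu_{it})_{t\ge1}$, $i=1,2,\dots$, are independent; and the error variances are bounded away from zero, $\inf_{i,t}\mathrm{Var}(\nu_{it})>0$; (B2) (i) the family $(x_{it})$ is independent of the family $(\nu_{it})$; writing $E_k=\{u\in\mathbb R^k:u_1+\dots+u_k=0\}$, (ii) there are constants $a_1,a_2>0$ such that, almost surely, for all sufficiently large $T$, all $i\le n(T)$ and all nonzero $u\in E_k$, $a_1\|u\|^2\le\frac1T u'X_iX_i'u\le a_2\|u\|^2$; (iii) almost surely, for every $i$ and every nonzero $u\in E_k$, $\max_{1\le t\le T}\langle u,\tilde x_{it}\rangle^2/(u'X_iX_i'u)\to0$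 as $T\to\infty$; and that the OLS estimator exists: almost surely, $\sum_{i\le n,t\le T}\tilde x_{it}\tilde x_{it}'$ is invertible for all sufficiently large $T$. Then $\mathrm{tr}(\hat R_T^2)-\mathrm{tr}(R_T^2)=o_p(1)$, that is, it converges to $0$ in probability as $T\to\infty$. -/

import Mathlib

open MeasureTheory ProbabilityTheory Filter Topology Matrix

namespace PanelLM

noncomputable section

/-! Units are indexed by `i < n`, times by `t < T` (both counted from `0`). An array `z i t` is
indexed by the unit `i` first and the time `t` second. -/

/-- The series `z` centred by its time average over the first `T` observations. -/
def centred {E : Type*} [AddCommGroup E] [Module ℝ E] (T : ℕ) (z : ℕ → E) (t : ℕ) : E :=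
  z t - (T : ℝ)⁻¹ • ∑ s ∈ Finset.range T, z s

/-- The `k × T` matrix `X_i` whose columns are the centred regressors of one unit. -/
def design {k : ℕ} (T : ℕ) (x : ℕ → Fin k → ℝ) : Matrix (Fin k) (Fin T) ℝ :=
  Matrix.of fun a t => centred T x t a

/-- The pooled `k × k` matrix `X X' = ∑ i, X_i X_i'`. -/
def pooledGram {k : ℕ} (n T : ℕ) (x : ℕ → ℕ → Fin k → ℝ) : Matrix (Fin k) (Fin k) ℝ :=
  ∑ i : Fin n, design T (x i) * (design T (x i))ᵀ

/-- The pooled OLS estimator `(∑ x̃_it x̃_it')⁻¹ (∑ x̃_it ỹ_it)` of the slope. -/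
def olsEstimator {k : ℕ} (n T : ℕ) (x : ℕ → ℕ → Fin k → ℝ) (y : ℕ → ℕ → ℝ) : Fin k → ℝ :=
  (pooledGram n T x)⁻¹ *ᵥ ∑ i : Fin n, design T (x i) *ᵥ fun t : Fin T => centred T (y i) t

/-- The OLS residual `ỹ_it - x̃_it' β̂`. -/
def olsResidual {k : ℕ} (n T : ℕ) (x : ℕ → ℕ → Fin k → ℝ) (y : ℕ → ℕ → ℝ) (i t : ℕ) : ℝ :=
  centred T (y i) t - centred T (x i) t ⬝ᵥ olsEstimator n T x y

/-- The `n × n` matrix `T⁻¹ ∑ t, e_t e_t'`. -/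
def sampleCov (n T : ℕ) (e : ℕ → ℕ → ℝ) : Matrix (Fin n) (Fin n) ℝ :=
  Matrix.of fun i j => (T : ℝ)⁻¹ * ∑ t ∈ Finset.range T, e i t * e j t

/-- The matrix `D^{-1/2} S D^{-1/2}` with `D = diag S`. -/
def corrOfCov {n : ℕ} (S : Matrix (Fin n) (Fin n) ℝ) : Matrix (Fin n) (Fin n) ℝ :=
  Matrix.diagonal (fun i => (√(S i i))⁻¹) * S * Matrix.diagonal (fun i => (√(S i i))⁻¹)

/-- The sample error correlation matrix `R_T`, built from the centred errors. -/
def errorCorr (n T : ℕ) (ν : ℕ → ℕ → ℝ) : Matrix (Fin n) (Fin n) ℝ :=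
  corrOfCov (sampleCov n T fun i => centred T (ν i))

/-- The sample residual correlation matrix, built from the OLS residuals. -/
def residualCorr {k : ℕ} (n T : ℕ) (x : ℕ → ℕ → Fin k → ℝ) (y : ℕ → ℕ → ℝ) :
    Matrix (Fin n) (Fin n) ℝ :=
  corrOfCov (sampleCov n T (olsResidual n T x y))

variable {Ω : Type*} [MeasurableSpace Ω]

/-- The error vectors `(ν_it)_i`, `t = 0, 1, …`, are i.i.d. with mean zero and uniformly bounded
sixth moments. -/
structure ErrorAssumption (P : Measure Ω) (ν : ℕ → ℕ → Ω → ℝ) : Prop where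
  measurable : ∀ i t, Measurable (ν i t)
  indep : iIndepFun (fun (t : ℕ) (ω : Ω) (i : ℕ) => ν i t ω) P
  identDistrib : ∀ t, IdentDistrib (fun ω i => ν i t ω) (fun ω i => ν i 0 ω) P P
  mean_zero : ∀ i t, ∫ ω, ν i t ω ∂P = 0
  sixth_moment : ∃ C > 0, ∀ i t, MemLp (ν i t) 6 P ∧ ∫ ω, |ν i t ω| ^ 6 ∂P ≤ C

/-- The null hypothesis: the errors are independent across the units. -/
def NullHypothesis (P : Measure Ω) (ν : ℕ → ℕ → Ω → ℝ) : Prop :=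
  iIndepFun (fun (i : ℕ) (ω : Ω) (t : ℕ) => ν i t ω) P

/-- The regressors are independent of the errors and the design matrices of the units are
regular along the vectors `u` with coordinate sum zero. The two-sided bound is asked for all large
`T` only: it cannot hold for `T = 1`, where the centred regressors vanish. -/
structure RegressorAssumption {k : ℕ} (P : Measure Ω) (n : ℕ → ℕ)
    (x : ℕ → ℕ → Ω → Fin k → ℝ) (ν : ℕ → ℕ → Ω → ℝ) : Prop where
  measurable : ∀ i t, Measurable (x i t)
  indep : IndepFun (fun ω i t => x i t ω) (fun ω i t => ν i t ω) P
  bounds : ∃ a₁ > 0, ∃ a₂ > 0, ∀ᵐ ω ∂P, ∀ᶠ T : ℕ in atTop, ∀ i < n T,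
    ∀ u : Fin k → ℝ, ∑ a, u a = 0 → u ≠ 0 →
      let X := design T fun t => x i t ω
      a₁ * (u ⬝ᵥ u) ≤ (T : ℝ)⁻¹ * (u ⬝ᵥ ((X * Xᵀ) *ᵥ u)) ∧
        (T : ℝ)⁻¹ * (u ⬝ᵥ ((X * Xᵀ) *ᵥ u)) ≤ a₂ * (u ⬝ᵥ u)
  lindeberg : ∀ᵐ ω ∂P, ∀ i, ∀ u : Fin k → ℝ, ∑ a, u a = 0 → u ≠ 0 →
    Tendsto (fun T : ℕ =>
      let X := design T fun t => x i t ω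
      (⨆ t : Fin T, (u ⬝ᵥ centred T (fun s => x i s ω) t) ^ 2) / (u ⬝ᵥ ((X * Xᵀ) *ᵥ u)))
      atTop (𝓝 0)

end

end PanelLM

/-! Let `v_i` be the centred error series of unit `i`, a vector in `ℝ^T`, and `e_i = v_i / ‖v_i‖`.
Then `tr(R²) = ∑_{i,j} ⟨e_i, e_j⟩²`. OLS replaces `v_i` by `v_i - ∑_a ξ_a w_{a,i}` with only `k`
random coefficients `ξ_a = ∑_j ⟨w_{a,j}, v_j⟩`, where `∑_i ‖w_{a,i}‖² = 1` and each `w_{a,i}` has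
coordinate sum zero (`exists_initialSegment_olsResidual_eq`). Given the regressors, `ξ_a` has
bounded second moment, so the perturbation is bounded in total over all units, while every `‖v_i‖`
has order at least `√T`.

The diagonal correlations equal one on both sides. Expanding the others in `π_i = ‖v_i‖⁻¹ ∑_a ξ_a
w_{a,i}` leaves first-order sums `∑_{i≠j} ⟨e_i, e_j⟩ ⟨π_i, e_j⟩`, a mixed sum with `⟨π_i, π_j⟩`, and
remainders (`abs_sum_sq_inner_unitVec_sub_le`). All are at most a constant times `T^{-1/2}` once six
statistics, collected in `perturbationControl`, are bounded in probability.

Their means are bounded through isotropy. The errors of one unit are i.i.d. over time, so `e_i` and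
`u_i = v_i / ‖v_i‖²` (cut off at small norms) have exchangeable coordinates with sum zero, and their
second moment matrices are multiples of `I - J/T`, with factors of order `1/T` and `1/T²`.
Independence across units allows integrating out one unit at a time. This produces the cancellation
needed in the first-order sum (`integral_abs_sum_inner_mul_inner_le`).

The norms are bounded below simultaneously for all units by an exponential lower tail estimate and a
union bound over `n = O(T)` units. Fubini and dominated convergence then pass from fixed to random
regressors, and the event that the Gram matrix is singular has vanishing probability. -/

namespace PanelLM

/-! ### Perturbation of squared correlations of unit vectors. -/

section Deterministic

variable {E ι : Type*} [NormedAddCommGroup E] [InnerProductSpace ℝ E]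

/-- The vector `v` scaled to unit length, `0` if `v = 0`. -/
noncomputable def unitVec (v : E) : E := ‖v‖⁻¹ • v

theorem unitVec_smul_pos {r : ℝ} (hr : 0 < r) (v : E) : unitVec (r • v) = unitVec v := by
  rcases eq_or_ne v 0 with rfl | hv
  · simp [unitVec]
  · have : ‖v‖ ≠ 0 := norm_ne_zero_iff.2 hv
    rw [unitVec, unitVec, norm_smul, smul_smul, Real.norm_of_nonneg hr.le]
    congr 1
    field_simp

theorem norm_unitVec_le_one (v : E) : ‖unitVec v‖ ≤ 1 := by
  rw [unitVec, norm_smul, norm_inv, norm_norm]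
  exact inv_mul_le_one_of_le₀ le_rfl (norm_nonneg _)

theorem norm_unitVec {v : E} (hv : v ≠ 0) : ‖unitVec v‖ = 1 := by
  rw [unitVec, norm_smul, norm_inv, norm_norm, inv_mul_cancel₀ (norm_ne_zero_iff.2 hv)]

/-- The effect on one squared correlation of perturbing the unit vectors `a`, `b`
by small vectors `p`, `q`. -/
theorem abs_sq_inner_unitVec_sub_le {a b p q : E} (ha : ‖a‖ = 1) (hb : ‖b‖ = 1)
    (hp : ‖p‖ ≤ 1 / 4) (hq : ‖q‖ ≤ 1 / 4) :
    |inner ℝ (unitVec (a - p)) (unitVec (b - q)) ^ 2 - inner ℝ a b ^ 2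
        + 2 * inner ℝ a b * inner ℝ p b + 2 * inner ℝ a b * inner ℝ a q
        - 2 * inner ℝ a b * inner ℝ p q| ≤
      16 * (|inner ℝ a p| + ‖p‖ ^ 2 + (|inner ℝ b q| + ‖q‖ ^ 2)) * inner ℝ a b ^ 2
        + 27 * (inner ℝ p b ^ 2 + inner ℝ a q ^ 2 + ‖p‖ ^ 2 * ‖q‖ ^ 2) := by
  have key : ∀ {a p : E}, ‖a‖ = 1 → ‖p‖ ≤ 1 / 4 →
      0 ≤ (‖a - p‖ ^ 2)⁻¹ ∧ (‖a - p‖ ^ 2)⁻¹ ≤ 2 ∧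
        |(‖a - p‖ ^ 2)⁻¹ - 1| ≤ 4 * (|inner ℝ a p| + ‖p‖ ^ 2) := by
    intro a p ha hp
    have h1 : 3 / 4 ≤ ‖a - p‖ := by
      have := norm_sub_norm_le a p
      linarith
    have h2 : (1 : ℝ) / 2 ≤ ‖a - p‖ ^ 2 := by nlinarith
    have h3 : (‖a - p‖ ^ 2)⁻¹ ≤ 2 := by
      rw [inv_le_comm₀ (by linarith) (by norm_num)]
      linarith
    refine ⟨by positivity, h3, ?_⟩
    have h4 : (‖a - p‖ ^ 2)⁻¹ - 1 = (‖a - p‖ ^ 2)⁻¹ * (2 * inner ℝ a p - ‖p‖ ^ 2) := by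
      have h5 : ‖a - p‖ ^ 2 ≠ 0 := by linarith
      have h6 := norm_sub_sq_real a p
      rw [ha] at h6
      field_simp
      linarith
    rw [h4, abs_mul, abs_of_nonneg (by positivity)]
    have h7 : |2 * inner ℝ a p - ‖p‖ ^ 2| ≤ 2 * (|inner ℝ a p| + ‖p‖ ^ 2) := by
      refine (abs_sub _ _).trans ?_
      rw [abs_mul, abs_two, abs_of_nonneg (sq_nonneg ‖p‖)]
      nlinarith [sq_nonneg ‖p‖]
    nlinarith [abs_nonneg (2 * inner ℝ a p - ‖p‖ ^ 2), abs_nonneg (inner ℝ a p)]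
  obtain ⟨ha0, ha2, hal⟩ := key ha hp
  obtain ⟨hb0, hb2, hbl⟩ := key hb hq
  have hr : inner ℝ (unitVec (a - p)) (unitVec (b - q)) ^ 2 =
      (‖a - p‖ ^ 2)⁻¹ * (‖b - q‖ ^ 2)⁻¹ * inner ℝ (a - p) (b - q) ^ 2 := by
    rw [unitVec, unitVec, real_inner_smul_left, real_inner_smul_right]
    simp only [inv_pow, mul_pow]
    ring
  have hρ : inner ℝ (a - p) (b - q) =
      inner ℝ a b + (inner ℝ p q - inner ℝ p b - inner ℝ a q) := by
    rw [inner_sub_left, inner_sub_right, inner_sub_right]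
    ring
  have hpq : inner ℝ p q ^ 2 ≤ ‖p‖ ^ 2 * ‖q‖ ^ 2 := by
    rw [← mul_pow, ← sq_abs]
    exact pow_le_pow_left₀ (abs_nonneg _) (abs_real_inner_le_norm _ _) 2
  rw [hr, hρ]
  generalize (‖a - p‖ ^ 2)⁻¹ = l at *
  generalize (‖b - q‖ ^ 2)⁻¹ = m at *
  generalize |inner ℝ a p| + ‖p‖ ^ 2 = A at *
  generalize |inner ℝ b q| + ‖q‖ ^ 2 = B at *
  generalize ‖p‖ ^ 2 * ‖q‖ ^ 2 = N at *
  generalize inner ℝ a b = r at *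
  generalize inner ℝ p q = x at *
  generalize inner ℝ p b = y at *
  generalize inner ℝ a q = z at *
  have hA : 0 ≤ A := by linarith [abs_nonneg (l - 1)]
  have hB : 0 ≤ B := by linarith [abs_nonneg (m - 1)]
  have hlm : |l * m - 1| ≤ 8 * (A + B) := by
    have : l * m - 1 = (l - 1) * m + (m - 1) := by ring
    rw [this]
    refine (abs_add_le _ _).trans ?_
    rw [abs_mul, abs_of_nonneg hb0]
    nlinarith [abs_nonneg (l - 1)]
  have hlm3 : |l * m - 1| ≤ 3 := by
    rw [abs_le]
    constructor <;> nlinarith [mul_nonneg ha0 hb0]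
  have hδ : (x - y - z) ^ 2 ≤ 3 * (y ^ 2 + z ^ 2 + N) := by
    nlinarith [sq_nonneg (x + y), sq_nonneg (x + z), sq_nonneg (y - z)]
  -- After removal of the terms linear in `x - y - z`, what remains is a normalisation error and a
  -- square.
  have e : l * m * (r + (x - y - z)) ^ 2 - r ^ 2 + 2 * r * y + 2 * r * z - 2 * r * x =
      (l * m - 1) * (r + (x - y - z)) ^ 2 + (x - y - z) ^ 2 := by ring
  rw [e]
  refine (abs_add_le _ _).trans ?_
  rw [abs_mul, abs_of_nonneg (sq_nonneg (r + (x - y - z))), abs_of_nonneg (sq_nonneg (x - y - z))]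
  have h8 : (r + (x - y - z)) ^ 2 ≤ 2 * r ^ 2 + 2 * (x - y - z) ^ 2 := by
    nlinarith [sq_nonneg (r - (x - y - z))]
  have h9 := mul_le_mul_of_nonneg_left h8 (abs_nonneg (l * m - 1))
  have h10 := mul_le_mul_of_nonneg_right hlm (by positivity : 0 ≤ 2 * r ^ 2)
  have h11 := mul_le_mul_of_nonneg_right hlm3 (by positivity : 0 ≤ 2 * (x - y - z) ^ 2)
  nlinarith

variable [Fintype ι] [DecidableEq ι]

theorem sum_erase_comm (f : ι → ι → ℝ) :
    ∑ i, ∑ j ∈ Finset.univ.erase i, f i j = ∑ i, ∑ j ∈ Finset.univ.erase i, f j i :=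
  Finset.sum_comm' (by simp [eq_comm])

/-- Stability of the sum of the squared correlations of unit vectors `e i` perturbed by `π i`. -/
theorem abs_sum_sq_inner_unitVec_sub_le {e π : ι → E} {η : ℝ} (he : ∀ i, ‖e i‖ = 1)
    (hη : η ≤ 1 / 16)
    (h1 : ∑ i, ∑ j ∈ Finset.univ.erase i, inner ℝ (π i) (e j) ^ 2 ≤ η)
    (h2 : ∑ i, ‖π i‖ ^ 2 ≤ η)
    (h3 : |∑ i, ∑ j ∈ Finset.univ.erase i, inner ℝ (e i) (e j) * inner ℝ (π i) (e j)| ≤ η)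
    (h4 : |∑ i, ∑ j ∈ Finset.univ.erase i, inner ℝ (e i) (e j) * inner ℝ (π i) (π j)| ≤ η)
    (h5 : ∑ i, (|inner ℝ (e i) (π i)| + ‖π i‖ ^ 2) *
      ∑ j ∈ Finset.univ.erase i, inner ℝ (e i) (e j) ^ 2 ≤ η) :
    |∑ i, ∑ j, inner ℝ (unitVec (e i - π i)) (unitVec (e j - π j)) ^ 2 -
      ∑ i, ∑ j, inner ℝ (e i) (e j) ^ 2| ≤ 150 * η := by
  have hη0 : 0 ≤ η := (Finset.sum_nonneg fun i _ => sq_nonneg _).trans h2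
  have hπ : ∀ i, ‖π i‖ ≤ 1 / 4 := fun i => by
    have := (Finset.single_le_sum (f := fun i => ‖π i‖ ^ 2) (fun i _ => sq_nonneg _)
      (Finset.mem_univ i)).trans (h2.trans hη)
    nlinarith [norm_nonneg (π i)]
  set R : ι → ι → ℝ := fun i j =>
    inner ℝ (unitVec (e i - π i)) (unitVec (e j - π j)) ^ 2 - inner ℝ (e i) (e j) ^ 2 with hR
  -- Diagonal correlations are one before and after the perturbation, provided that the perturbed
  -- vector is nonzero.
  have hdiag : ∀ i, R i i = 0 := fun i => by
    have hne : e i - π i ≠ 0 := fun h => by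
      have h' := he i
      rw [sub_eq_zero.1 h] at h'
      linarith [hπ i]
    simp [hR, norm_unitVec hne, he i]
  have hsum : ∑ i, ∑ j, inner ℝ (unitVec (e i - π i)) (unitVec (e j - π j)) ^ 2 -
      ∑ i, ∑ j, inner ℝ (e i) (e j) ^ 2 = ∑ i, ∑ j ∈ Finset.univ.erase i, R i j := by
    rw [← Finset.sum_sub_distrib]
    refine Finset.sum_congr rfl fun i _ => ?_
    rw [← Finset.sum_sub_distrib, ← Finset.add_sum_erase _ _ (Finset.mem_univ i)]
    change R i i + _ = _
    rw [hdiag, zero_add]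
  rw [hsum]
  set S : (ι → ι → ℝ) → ℝ := fun f => ∑ i, ∑ j ∈ Finset.univ.erase i, f i j with hS
  have S_add : ∀ f g, S (fun i j => f i j + g i j) = S f + S g := fun f g => by
    simp only [hS, Finset.sum_add_distrib]
  have S_mul : ∀ c f, S (fun i j => c * f i j) = c * S f := fun c f => by
    simp only [hS, Finset.mul_sum]
  have S_mono : ∀ f g, (∀ i j, f i j ≤ g i j) → S f ≤ S g := fun f g h =>
    Finset.sum_le_sum fun i _ => Finset.sum_le_sum fun j _ => h i j
  have S_abs : ∀ f, |S f| ≤ S fun i j => |f i j| := fun f =>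
    (Finset.abs_sum_le_sum_abs _ _).trans
      (Finset.sum_le_sum fun i _ => Finset.abs_sum_le_sum_abs _ _)
  have S_comm : ∀ f, S f = S fun i j => f j i := sum_erase_comm
  set r : ι → ι → ℝ := fun i j => inner ℝ (e i) (e j)
  set m : ι → ℝ := fun i => |inner ℝ (e i) (π i)| + ‖π i‖ ^ 2
  have b3 : S (fun i j => r i j * inner ℝ (e i) (π j)) =
      S (fun i j => r i j * inner ℝ (π i) (e j)) := by
    rw [S_comm]
    simp only [r, real_inner_comm]
  have b1 : S (fun i j => inner ℝ (e i) (π j) ^ 2) = S (fun i j => inner ℝ (π i) (e j) ^ 2) := by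
    rw [S_comm]
    simp only [real_inner_comm]
  have b5 : S (fun i j => m i * r i j ^ 2) ≤ η := by
    simpa only [hS, Finset.mul_sum] using h5
  have b5' : S (fun i j => m j * r i j ^ 2) ≤ η := by
    rw [S_comm]
    simpa only [r, real_inner_comm] using b5
  have b2 : S (fun i j => ‖π i‖ ^ 2 * ‖π j‖ ^ 2) ≤ η := by
    have : S (fun i j => ‖π i‖ ^ 2 * ‖π j‖ ^ 2) ≤ (∑ i, ‖π i‖ ^ 2) * ∑ j, ‖π j‖ ^ 2 := by
      rw [Finset.sum_mul]
      refine Finset.sum_le_sum fun i _ => ?_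
      rw [Finset.mul_sum]
      exact Finset.sum_le_sum_of_subset_of_nonneg (Finset.subset_univ _)
        fun j _ _ => by positivity
    have h0 : 0 ≤ ∑ i, ‖π i‖ ^ 2 := Finset.sum_nonneg fun i _ => sq_nonneg _
    nlinarith
  have hmain := (S_abs _).trans (S_mono _ _ fun i j =>
    abs_sq_inner_unitVec_sub_le (he i) (he j) (hπ i) (hπ j))
  have hL : S (fun i j => inner ℝ (unitVec (e i - π i)) (unitVec (e j - π j)) ^ 2
        - inner ℝ (e i) (e j) ^ 2
        + 2 * inner ℝ (e i) (e j) * inner ℝ (π i) (e j)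
        + 2 * inner ℝ (e i) (e j) * inner ℝ (e i) (π j)
        - 2 * inner ℝ (e i) (e j) * inner ℝ (π i) (π j)) =
      S R + 2 * S (fun i j => r i j * inner ℝ (π i) (e j))
        + 2 * S (fun i j => r i j * inner ℝ (e i) (π j))
        + (-2) * S (fun i j => r i j * inner ℝ (π i) (π j)) := by
    rw [← S_mul, ← S_mul, ← S_mul, ← S_add, ← S_add, ← S_add]
    congr 1
    ext i j
    simp only [r, hR]
    ring
  have hU : S (fun i j => 16 * (|inner ℝ (e i) (π i)| + ‖π i‖ ^ 2 +
        (|inner ℝ (e j) (π j)| + ‖π j‖ ^ 2)) * inner ℝ (e i) (e j) ^ 2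
        + 27 * (inner ℝ (π i) (e j) ^ 2 + inner ℝ (e i) (π j) ^ 2 + ‖π i‖ ^ 2 * ‖π j‖ ^ 2)) =
      16 * S (fun i j => m i * r i j ^ 2) + 16 * S (fun i j => m j * r i j ^ 2)
        + 27 * S (fun i j => inner ℝ (π i) (e j) ^ 2)
        + 27 * S (fun i j => inner ℝ (e i) (π j) ^ 2)
        + 27 * S (fun i j => ‖π i‖ ^ 2 * ‖π j‖ ^ 2) := by
    rw [← S_mul, ← S_mul, ← S_mul, ← S_mul, ← S_mul, ← S_add, ← S_add, ← S_add, ← S_add]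
    congr 1
    ext i j
    simp only [r, m]
    ring
  rw [hL, hU, b3, b1] at hmain
  change S (fun i j => inner ℝ (π i) (e j) ^ 2) ≤ η at h1
  change |S (fun i j => r i j * inner ℝ (π i) (e j))| ≤ η at h3
  change |S (fun i j => r i j * inner ℝ (π i) (π j))| ≤ η at h4
  change |S R| ≤ 150 * η
  rw [abs_le] at *
  -- The coefficients of `η` add up to `4 + 2 + 16 * 2 + 27 * 3 = 119`.
  constructor <;> linarith

end Deterministic

/-! ### Traces as sums of squared inner products, and the form of the OLS residuals. -/

section Algebra

/-- The first `T` values of a series as a Euclidean vector. -/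
noncomputable def initialSegment (T : ℕ) (e : ℕ → ℝ) : EuclideanSpace ℝ (Fin T) :=
  WithLp.toLp 2 fun t => e t

@[simp] theorem initialSegment_apply (T : ℕ) (e : ℕ → ℝ) (t : Fin T) :
    initialSegment T e t = e t := rfl

theorem inner_eq_sum_mul {τ : Type*} [Fintype τ] (v w : EuclideanSpace ℝ τ) :
    inner ℝ v w = ∑ t, v t * w t := by
  simp [PiLp.inner_apply, mul_comm]

theorem sampleCov_apply_eq_inner (n T : ℕ) (e : ℕ → ℕ → ℝ) (i j : Fin n) :
    sampleCov n T e i j = (T : ℝ)⁻¹ * inner ℝ (initialSegment T (e i)) (initialSegment T (e j)) := by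
  simp [sampleCov, inner_eq_sum_mul, Finset.sum_range]

theorem corrOfCov_apply {n : ℕ} (S : Matrix (Fin n) (Fin n) ℝ) (i j : Fin n) :
    corrOfCov S i j = (√(S i i))⁻¹ * S i j * (√(S j j))⁻¹ := by
  simp [corrOfCov, Matrix.mul_diagonal, Matrix.diagonal_mul]

theorem corrOfCov_sampleCov_apply {n T : ℕ} (hT : 0 < T) (e : ℕ → ℕ → ℝ) (i j : Fin n) :
    corrOfCov (sampleCov n T e) i j =
      inner ℝ (unitVec (initialSegment T (e i))) (unitVec (initialSegment T (e j))) := by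
  have hT' : (0 : ℝ) < (T : ℝ)⁻¹ := by positivity
  simp only [corrOfCov_apply, sampleCov_apply_eq_inner, real_inner_self_eq_norm_sq,
    Real.sqrt_mul hT'.le, Real.sqrt_sq (norm_nonneg _), unitVec, real_inner_smul_left,
    real_inner_smul_right, mul_inv]
  have h := Real.mul_self_sqrt hT'.le
  have h0 : √(T : ℝ)⁻¹ ≠ 0 := (Real.sqrt_pos.2 hT').ne'
  have h1 : (√(T : ℝ)⁻¹)⁻¹ * (T : ℝ)⁻¹ * (√(T : ℝ)⁻¹)⁻¹ = 1 := by
    have h2 : (√(T : ℝ)⁻¹)⁻¹ * (√(T : ℝ)⁻¹ * √(T : ℝ)⁻¹) * (√(T : ℝ)⁻¹)⁻¹ = 1 := by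
      field_simp
    rwa [h] at h2
  linear_combination (‖initialSegment T (e i)‖⁻¹ * (‖initialSegment T (e j)‖⁻¹ *
    inner ℝ (initialSegment T (e i)) (initialSegment T (e j)))) * h1

theorem trace_sq_corrOfCov_sampleCov {n T : ℕ} (hT : 0 < T) (e : ℕ → ℕ → ℝ) :
    (corrOfCov (sampleCov n T e) ^ 2).trace = ∑ i : Fin n, ∑ j : Fin n,
      inner ℝ (unitVec (initialSegment T (e i))) (unitVec (initialSegment T (e j))) ^ 2 := by
  simp only [Matrix.trace, Matrix.diag, pow_two, Matrix.mul_apply, corrOfCov_sampleCov_apply hT]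
  simp only [real_inner_comm]

theorem sum_centred {T : ℕ} (hT : 0 < T) (z : ℕ → ℝ) : ∑ t : Fin T, centred T z t = 0 := by
  have : (T : ℝ) ≠ 0 := by positivity
  simp only [centred, Finset.sum_sub_distrib, Finset.sum_const, Finset.card_univ,
    Fintype.card_fin, Finset.sum_range, smul_eq_mul, nsmul_eq_mul]
  field_simp
  simp

theorem centred_apply {k : ℕ} (T : ℕ) (x : ℕ → Fin k → ℝ) (t : ℕ) (a : Fin k) :
    centred T x t a = centred T (fun s => x s a) t := by
  simp [centred]

theorem centred_panel {k T : ℕ} (hT : 0 < T) (x : ℕ → Fin k → ℝ) (ν : ℕ → ℝ) (α μ : ℝ)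
    (β : Fin k → ℝ) (t : ℕ) :
    centred T (fun s => α + x s ⬝ᵥ β + μ + ν s) t = centred T x t ⬝ᵥ β + centred T ν t := by
  have : (T : ℝ) ≠ 0 := by positivity
  simp only [centred, Finset.sum_add_distrib, Finset.sum_const, Finset.card_range, smul_eq_mul,
    nsmul_eq_mul, sub_dotProduct, smul_dotProduct, sum_dotProduct]
  field_simp
  ring

theorem posSemidef_pooledGram {k : ℕ} (n T : ℕ) (x : ℕ → ℕ → Fin k → ℝ) :
    (pooledGram n T x).PosSemidef :=
  Matrix.posSemidef_sum _ fun i _ => by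
    simpa using Matrix.posSemidef_self_mul_conjTranspose (design T (x i))

open scoped MatrixOrder Matrix.Norms.L2Operator in
/-- The OLS residuals are the centred errors minus their projection on the regressors. -/
theorem exists_initialSegment_olsResidual_eq {k n T : ℕ} (hT : 0 < T) (x : ℕ → ℕ → Fin k → ℝ)
    (hG : IsUnit (pooledGram n T x)) :
    ∃ w : Fin k → Fin n → EuclideanSpace ℝ (Fin T),
      (∀ a i, ∑ t, w a i t = 0) ∧ (∀ a, ∑ i, ‖w a i‖ ^ 2 = 1) ∧
      ∀ (y ν : ℕ → ℕ → ℝ) (α : ℝ) (β : Fin k → ℝ) (μ : ℕ → ℝ),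
        (∀ i t, y i t = α + x i t ⬝ᵥ β + μ i + ν i t) → ∀ i : Fin n,
        initialSegment T (olsResidual n T x y i) = initialSegment T (centred T (ν i)) -
          ∑ a, (∑ j : Fin n, inner ℝ (w a j) (initialSegment T (centred T (ν j)))) • w a i := by
  -- With `G` the pooled Gram matrix and `G⁻¹ = MᵀM`, one gets `M G Mᵀ = 1`: the rows of `M (X_1, …,
  -- X_n)` are orthonormal in the pooled space, and `w a i` is the block of row `a` belonging to
  -- unit `i`. These vectors depend on the regressors only.
  obtain ⟨M, hM⟩ : ∃ M : Matrix (Fin k) (Fin k) ℝ, (pooledGram n T x)⁻¹ = Mᵀ * M := by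
    obtain ⟨M, hM⟩ := CStarAlgebra.nonneg_iff_eq_star_mul_self.1
      (posSemidef_pooledGram n T x).inv.nonneg
    exact ⟨M, by simpa [Matrix.star_eq_conjTranspose] using hM⟩
  have hGdet : IsUnit (pooledGram n T x).det := (Matrix.isUnit_iff_isUnit_det _).1 hG
  have hMGM : M * pooledGram n T x * Mᵀ = 1 := by
    have h1 : (Mᵀ * M) * pooledGram n T x = 1 := by rw [← hM, Matrix.nonsing_inv_mul _ hGdet]
    have h2 : (M * pooledGram n T x) * Mᵀ = 1 := by
      rw [Matrix.mul_assoc] at h1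
      exact mul_eq_one_comm.1 h1
    exact h2
  refine ⟨fun a i => WithLp.toLp 2 fun t => (M * design T (x i)) a t, fun a i => ?_, fun a => ?_,
    fun y ν α β μ hy i => ?_⟩
  · simp only [Matrix.mul_apply, design, Matrix.of_apply]
    rw [Finset.sum_comm]
    refine Finset.sum_eq_zero fun b _ => ?_
    rw [← Finset.mul_sum]
    simp only [centred_apply]
    rw [sum_centred hT, mul_zero]
  · have h := congrFun (congrFun hMGM a) a
    rw [pooledGram, Matrix.mul_sum, Matrix.sum_mul, Matrix.sum_apply, Matrix.one_apply_eq] at h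
    rw [← h]
    refine Finset.sum_congr rfl fun i _ => ?_
    rw [← Matrix.mul_assoc, Matrix.mul_assoc, ← Matrix.transpose_mul, Matrix.mul_apply,
      EuclideanSpace.norm_sq_eq]
    simp [pow_two]
  · have hols : olsEstimator n T x y = β + (pooledGram n T x)⁻¹ *ᵥ
        ∑ j : Fin n, design T (x j) *ᵥ fun t : Fin T => centred T (ν j) t := by
      have h1 : ∀ j : Fin n, (design T (x j) *ᵥ fun t : Fin T => centred T (y j) t) =
          (design T (x j) * (design T (x j))ᵀ) *ᵥ β +
            design T (x j) *ᵥ fun t : Fin T => centred T (ν j) t := fun j => by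
        rw [← Matrix.mulVec_mulVec, ← Matrix.mulVec_add]
        congr 1
        ext t
        rw [show y j = fun s => α + x j s ⬝ᵥ β + μ j + ν j s from funext (hy j), centred_panel hT]
        rfl
      rw [olsEstimator]
      simp only [h1, Finset.sum_add_distrib]
      rw [Matrix.mulVec_add, ← Matrix.sum_mulVec, ← pooledGram, Matrix.mulVec_mulVec,
        Matrix.nonsing_inv_mul _ hGdet, Matrix.one_mulVec]
    ext t
    have h2 : ∀ z : Fin k → ℝ, centred T (x i) t ⬝ᵥ ((pooledGram n T x)⁻¹ *ᵥ z) =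
        ∑ a, (M *ᵥ z) a * (M * design T (x i)) a t := fun z => by
      rw [hM, ← Matrix.mulVec_mulVec, Matrix.dotProduct_mulVec, Matrix.vecMul_transpose,
        dotProduct]
      refine Finset.sum_congr rfl fun a _ => ?_
      rw [mul_comm]
      rfl
    have h3 : ∀ a, (M *ᵥ ∑ j : Fin n, design T (x j) *ᵥ fun t : Fin T => centred T (ν j) t) a =
        ∑ j : Fin n, inner ℝ (WithLp.toLp 2 fun t => (M * design T (x j)) a t)
          (initialSegment T (centred T (ν j))) := fun a => by
      rw [Matrix.mulVec_sum, Finset.sum_apply]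
      refine Finset.sum_congr rfl fun j _ => ?_
      rw [Matrix.mulVec_mulVec, inner_eq_sum_mul]
      rfl
    rw [initialSegment_apply, olsResidual, hols, dotProduct_add, h2,
      show y i = fun s => α + x i s ⬝ᵥ β + μ i + ν i s from funext (hy i), centred_panel hT]
    simp only [h3, PiLp.sub_apply, initialSegment_apply, WithLp.ofLp_sum, Finset.sum_apply,
      PiLp.smul_apply, smul_eq_mul]
    ring

end Algebra

/-! ### Uniform lower bound for the norms of the centred error series. -/

section LowerTail

/-- Since `1 + a + a²/2 ≤ exp a` and `(1 - a + a²/2)(1 + a + a²/2) = 1 + a⁴/4 ≥ 1`. -/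
theorem exp_neg_le_quadratic {a : ℝ} (ha : 0 ≤ a) : Real.exp (-a) ≤ 1 - a + a ^ 2 / 2 := by
  have h := Real.quadratic_le_exp_of_nonneg ha
  have h1 : 0 ≤ 1 - a + a ^ 2 / 2 := by nlinarith [sq_nonneg (a - 1)]
  rw [Real.exp_neg, inv_le_iff_one_le_mul₀ (Real.exp_pos a)]
  nlinarith [mul_le_mul_of_nonneg_left h h1, sq_nonneg (a ^ 2)]

variable {Ω : Type*} [MeasurableSpace Ω] {P : Measure Ω} [IsProbabilityMeasure P]

theorem integrable_exp_neg_mul {X : Ω → ℝ} (hX : Measurable X) (hX0 : ∀ ω, 0 ≤ X ω) {s : ℝ}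
    (hs : s ≤ 0) : Integrable (fun ω => Real.exp (s * X ω)) P := by
  refine Integrable.of_mem_Icc 0 1 (by fun_prop) (ae_of_all _ fun ω => ⟨by positivity, ?_⟩)
  exact Real.exp_le_one_iff.2 (mul_nonpos_of_nonpos_of_nonneg hs (hX0 ω))

/-- Integrate the quadratic bound for `exp (-s X)` and use `1 + y ≤ exp y`. For nonnegative
variables two moments suffice for exponential control of the lower tail. -/
theorem mgf_neg_le_exp {X : Ω → ℝ} (hX : Measurable X) (hX0 : ∀ ω, 0 ≤ X ω)
    (hX2 : MemLp X 2 P) {σ K s : ℝ} (hs : 0 ≤ s) (hσ : σ ≤ ∫ ω, X ω ∂P)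
    (hK : ∫ ω, X ω ^ 2 ∂P ≤ K) : mgf X P (-s) ≤ Real.exp (-(s * σ) + s ^ 2 * K / 2) := by
  have h1 : Integrable X P := hX2.integrable one_le_two
  have h2 : Integrable (fun ω => X ω ^ 2) P := hX2.integrable_sq
  have h3 : mgf X P (-s) ≤ ∫ ω, (1 - s * X ω + s ^ 2 / 2 * X ω ^ 2) ∂P := by
    refine integral_mono (integrable_exp_neg_mul hX hX0 (by linarith))
      (((integrable_const _).sub (h1.const_mul s)).add (h2.const_mul _)) fun ω => ?_
    have := exp_neg_le_quadratic (mul_nonneg hs (hX0 ω))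
    simp only [neg_mul]
    linarith
  have h1' : Integrable (fun ω => 1 - s * X ω) P := (integrable_const _).sub (h1.const_mul s)
  rw [integral_add h1' (h2.const_mul _), integral_sub (integrable_const _) (h1.const_mul s), integral_const_mul, integral_const_mul,
    integral_const] at h3
  simp only [probReal_univ, smul_eq_mul, mul_one] at h3
  have h4 := Real.add_one_le_exp (-(s * σ) + s ^ 2 * K / 2)
  nlinarith [mul_le_mul_of_nonneg_left hσ hs, mul_le_mul_of_nonneg_left hK (sq_nonneg s)]

/-- Exponential lower tail bound for sums of independent nonnegative variables. -/
theorem measureReal_sum_le_le_exp {X : ℕ → Ω → ℝ} (hX : ∀ l, Measurable (X l))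
    (hX0 : ∀ l ω, 0 ≤ X l ω) (hX2 : ∀ l, MemLp (X l) 2 P)
    (hind : ∀ m, IndepFun (fun ω => ∑ l ∈ Finset.range m, X l ω) (X m) P)
    {σ K : ℝ} (hσ0 : 0 < σ) (hK0 : 0 < K) (hσ : ∀ l, σ ≤ ∫ ω, X l ω ∂P)
    (hK : ∀ l, ∫ ω, X l ω ^ 2 ∂P ≤ K) (m : ℕ) :
    P.real {ω | ∑ l ∈ Finset.range m, X l ω ≤ σ / 4 * m} ≤
      Real.exp (-(σ ^ 2 / (4 * K) * m)) := by
  -- This minimises `-s σ + s² K / 2`, with value `-σ² / (2K)` per summand. Half of this gain is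
  -- spent on the threshold `σ / 4 * m` in Chernoff's bound.
  set s : ℝ := σ / K with hs
  have hs0 : 0 ≤ s := by positivity
  have hsum : ∀ m, Measurable fun ω => ∑ l ∈ Finset.range m, X l ω := fun m =>
    Finset.measurable_fun_sum _ fun l _ => hX l
  have hsum0 : ∀ m ω, 0 ≤ ∑ l ∈ Finset.range m, X l ω := fun m ω =>
    Finset.sum_nonneg fun l _ => hX0 l ω
  have hmgf : ∀ m, mgf (fun ω => ∑ l ∈ Finset.range m, X l ω) P (-s) ≤
      Real.exp (-(σ ^ 2 / (2 * K) * m)) := by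
    intro m
    induction m with
    | zero => simp [mgf]
    | succ m ih =>
      have h1 : (fun ω => ∑ l ∈ Finset.range (m + 1), X l ω) =
          (fun ω => ∑ l ∈ Finset.range m, X l ω) + X m := by
        ext ω
        simp [Finset.sum_range_succ]
      rw [h1, (hind m).mgf_add
        (integrable_exp_neg_mul (hsum m) (hsum0 m) (by linarith)).aestronglyMeasurable
        (integrable_exp_neg_mul (hX m) (hX0 m) (by linarith)).aestronglyMeasurable]
      refine (mul_le_mul ih (mgf_neg_le_exp (hX m) (hX0 m) (hX2 m) hs0 (hσ m) (hK m))
        mgf_nonneg (Real.exp_nonneg _)).trans ?_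
      rw [← Real.exp_add]
      apply le_of_eq
      congr 1
      rw [hs]
      push_cast
      field_simp
      ring
  refine (measure_le_le_exp_mul_mgf _ (neg_nonpos.2 hs0)
    (integrable_exp_neg_mul (hsum m) (hsum0 m) (by linarith))).trans ?_
  refine (mul_le_mul_of_nonneg_left (hmgf m) (Real.exp_nonneg _)).trans ?_
  rw [← Real.exp_add]
  apply le_of_eq
  congr 1
  rw [hs]
  field_simp
  ring

/-- Differences are unaffected by centring, and `(a - b)² ≤ 2 (a² + b²)`. Disjoint pairs thus
replace the dependent centred values by independent nonnegative summands; for odd `T` the last time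
is dropped. -/
theorem sum_pair_sq_le_norm_sq (T : ℕ) (z : ℕ → ℝ) :
    ∑ l ∈ Finset.range (T / 2), (z (2 * l) - z (2 * l + 1)) ^ 2 ≤
      2 * ‖initialSegment T (centred T z)‖ ^ 2 := by
  have h1 : ∀ m, ∑ l ∈ Finset.range m, (z (2 * l) - z (2 * l + 1)) ^ 2 ≤
      2 * ∑ t ∈ Finset.range (2 * m), centred T z t ^ 2 := fun m => by
    induction m with
    | zero => simp
    | succ m ih =>
      rw [Finset.sum_range_succ, show 2 * (m + 1) = 2 * m + 1 + 1 by ring, Finset.sum_range_succ,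
        Finset.sum_range_succ]
      have : z (2 * m) - z (2 * m + 1) = centred T z (2 * m) - centred T z (2 * m + 1) := by
        simp [centred]
      rw [this]
      nlinarith [sq_nonneg (centred T z (2 * m) + centred T z (2 * m + 1))]
  refine (h1 _).trans ?_
  rw [EuclideanSpace.norm_sq_eq]
  simp only [initialSegment_apply, Real.norm_eq_abs, sq_abs]
  rw [← Finset.sum_range fun t => centred T z t ^ 2]
  have : 2 * (T / 2) ≤ T := by omega
  have := Finset.sum_le_sum_of_subset_of_nonneg (Finset.range_subset_range.2 this)
    (f := fun t => centred T z t ^ 2) fun t _ _ => sq_nonneg _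
  linarith

/-- A centred series of independent errors has norm at least of order `√T` with high
probability. -/
theorem measureReal_norm_sq_centred_lt_le {z : ℕ → Ω → ℝ} (hz : ∀ t, Measurable (z t))
    (hind : iIndepFun z P) (hz4 : ∀ t, MemLp (z t) 4 P) (hz0 : ∀ t, ∫ ω, z t ω ∂P = 0)
    {σ K : ℝ} (hσ0 : 0 < σ) (hK0 : 0 < K) (hσ : ∀ t, σ ≤ ∫ ω, z t ω ^ 2 ∂P)
    (hK : ∀ t, ∫ ω, z t ω ^ 4 ∂P ≤ K) {T : ℕ} (hT : 2 ≤ T) :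
    P.real {ω | ‖initialSegment T (centred T fun t => z t ω)‖ ^ 2 < σ / 12 * T} ≤
      Real.exp (-(σ ^ 2 / (16 * K) * ((T / 2 : ℕ) : ℝ))) := by
  have hz2 : ∀ t, MemLp (z t) 2 P := fun t => (hz4 t).mono_exponent (by norm_num)
  have hD : ∀ l, MemLp (fun ω => z (2 * l) ω - z (2 * l + 1) ω) 4 P := fun l =>
    (hz4 _).sub (hz4 _)
  have hpow : ∀ {f : Ω → ℝ}, MemLp f 4 P → Integrable (fun ω => f ω ^ 4) P := fun {f} hf => by
    have := hf.integrable_norm_pow (p := 4) (by norm_num)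
    simpa [Even.pow_abs (show Even 4 by decide)] using this
  have hsq : ∀ {f : Ω → ℝ}, Measurable f → MemLp f 4 P → MemLp (fun ω => f ω ^ 2) 2 P :=
    fun {f} hfm hf => by
      rw [memLp_two_iff_integrable_sq (by fun_prop)]
      simpa [← pow_mul] using hpow hf
  -- A squared pair difference has mean at least `2σ` and second moment at most `8 (K + K)`. The
  -- threshold becomes `σ / 2` per pair, and `T ≤ 3 ⌊T/2⌋` for `T ≥ 2` leads to the constant `σ /
  -- 12`.
  have key := measureReal_sum_le_le_exp (P := P)
    (X := fun l ω => (z (2 * l) ω - z (2 * l + 1) ω) ^ 2)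
    (fun l => ((hz _).sub (hz _)).pow_const 2) (fun l ω => sq_nonneg _)
    (fun l => hsq ((hz _).sub (hz _)) (hD l))
    (fun m => ?_) (σ := 2 * σ) (K := 16 * K) (by positivity) (by positivity)
    (fun l => ?_) (fun l => ?_) (T / 2)
  · refine (ENNReal.toReal_mono (measure_ne_top _ _) (measure_mono fun ω hω => ?_)).trans
      (key.trans (le_of_eq ?_))
    · simp only [Set.mem_ofPred_eq] at hω ⊢
      refine (sum_pair_sq_le_norm_sq T fun t => z t ω).trans ?_
      have h3 : (T : ℝ) ≤ 3 * ((T / 2 : ℕ) : ℝ) := by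
        have : T ≤ 3 * (T / 2) := by omega
        exact_mod_cast this
      nlinarith
    · congr 1
      field_simp
      ring
  · have h := hind.indepFun_finset (Finset.range (2 * m)) {2 * m, 2 * m + 1}
      (by rw [Finset.disjoint_left]; intro a; simp; omega) hz
    have h1 := h.comp
      (φ := fun f : (Finset.range (2 * m) → ℝ) => ∑ l ∈ (Finset.range m).attach,
        (f ⟨2 * l, by have := Finset.mem_range.1 l.2; simp; omega⟩ -
          f ⟨2 * l + 1, by have := Finset.mem_range.1 l.2; simp; omega⟩) ^ 2)
      (ψ := fun f : (({2 * m, 2 * m + 1} : Finset ℕ) → ℝ) =>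
        (f ⟨2 * m, by simp⟩ - f ⟨2 * m + 1, by simp⟩) ^ 2)
      (by fun_prop) (by fun_prop)
    have h2 : (fun ω => ∑ l ∈ Finset.range m, (z (2 * l) ω - z (2 * l + 1) ω) ^ 2) =
        fun ω => ∑ l ∈ (Finset.range m).attach,
          (z (2 * (l : ℕ)) ω - z (2 * (l : ℕ) + 1) ω) ^ 2 := by
      ext ω
      rw [Finset.sum_attach (Finset.range m)
        fun l => (z (2 * l) ω - z (2 * l + 1) ω) ^ 2]
    rw [h2]
    exact h1
  · have hi : IndepFun (z (2 * l)) (z (2 * l + 1)) P := hind.indepFun (by omega)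
    have hprod : Integrable (fun ω => z (2 * l) ω * z (2 * l + 1) ω) P :=
      (hz2 _).integrable_mul (hz2 _)
    have h0 : ∫ ω, z (2 * l) ω * z (2 * l + 1) ω ∂P = 0 := by
      have := hi.integral_mul_eq_mul_integral (hz _).aestronglyMeasurable
        (hz _).aestronglyMeasurable
      simpa [hz0] using this
    have he : ∀ ω, (z (2 * l) ω - z (2 * l + 1) ω) ^ 2 =
        z (2 * l) ω ^ 2 + z (2 * l + 1) ω ^ 2 - 2 * (z (2 * l) ω * z (2 * l + 1) ω) := fun ω => by
      ring
    simp only [he]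
    have h1 : Integrable (fun ω => z (2 * l) ω ^ 2 + z (2 * l + 1) ω ^ 2) P :=
      (hz2 _).integrable_sq.add (hz2 _).integrable_sq
    rw [integral_sub h1 (hprod.const_mul 2),
      integral_add (hz2 _).integrable_sq (hz2 _).integrable_sq, integral_const_mul, h0]
    linarith [hσ (2 * l), hσ (2 * l + 1)]
  · have h1 : ∫ ω, ((z (2 * l) ω - z (2 * l + 1) ω) ^ 2) ^ 2 ∂P ≤
        ∫ ω, 8 * (z (2 * l) ω ^ 4 + z (2 * l + 1) ω ^ 4) ∂P := by
      refine integral_mono (by simpa [← pow_mul] using hpow (hD l))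
        (((hpow (hz4 _)).add (hpow (hz4 _))).const_mul 8) fun ω => ?_
      simp only
      generalize z (2 * l) ω = a
      generalize z (2 * l + 1) ω = b
      have h2 : (a - b) ^ 2 ≤ 2 * (a ^ 2 + b ^ 2) := by nlinarith [sq_nonneg (a + b)]
      have h3 : ((a - b) ^ 2) ^ 2 ≤ (2 * (a ^ 2 + b ^ 2)) ^ 2 :=
        pow_le_pow_left₀ (sq_nonneg _) h2 2
      nlinarith [sq_nonneg (a ^ 2 - b ^ 2)]
    rw [integral_const_mul, integral_add (hpow (hz4 _)) (hpow (hz4 _))] at h1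
    linarith [hK (2 * l), hK (2 * l + 1)]

/-- This closes the union bound over the units: `n` grows linearly and the tail decays
exponentially. Rounding `T / 2` down costs the factor `exp (δ / 2)`. -/
theorem tendsto_mul_exp_neg_half {n : ℕ → ℕ} {c : ℝ}
    (hn : Tendsto (fun T : ℕ => (n T : ℝ) / (T : ℝ)) atTop (𝓝 c)) {δ : ℝ} (hδ : 0 < δ) :
    Tendsto (fun T : ℕ => (n T : ℝ) * Real.exp (-(δ * ((T / 2 : ℕ) : ℝ)))) atTop (𝓝 0) := by
  have h1 : Tendsto (fun T : ℕ => (δ / 2 * (T : ℝ)) ^ 1 * Real.exp (-(δ / 2 * (T : ℝ)))) atTop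
      (𝓝 0) :=
    (Real.tendsto_pow_mul_exp_neg_atTop_nhds_zero 1).comp
      (tendsto_natCast_atTop_atTop.const_mul_atTop (by positivity))
  have h2 := (hn.mul h1).mul_const (2 / δ * Real.exp (δ / 2))
  rw [mul_zero, zero_mul] at h2
  refine squeeze_zero' (Eventually.of_forall fun T => by positivity) ?_ h2
  filter_upwards [eventually_gt_atTop 0] with T hT
  have hT' : (0 : ℝ) < T := by exact_mod_cast hT
  have h3 : (T : ℝ) / 2 - 1 / 2 ≤ ((T / 2 : ℕ) : ℝ) := by
    have : T ≤ 2 * (T / 2) + 1 := by omega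
    have : (T : ℝ) ≤ 2 * ((T / 2 : ℕ) : ℝ) + 1 := by exact_mod_cast this
    linarith
  have h4 : (n T : ℝ) / T * ((δ / 2 * (T : ℝ)) ^ 1 * Real.exp (-(δ / 2 * (T : ℝ)))) *
      (2 / δ * Real.exp (δ / 2)) = n T * Real.exp (-(δ / 2 * (T : ℝ)) + δ / 2) := by
    rw [Real.exp_add]
    field_simp
  rw [h4]
  gcongr
  nlinarith

theorem ErrorAssumption.memLp_four {ν : ℕ → ℕ → Ω → ℝ} (hν : ErrorAssumption P ν) (i t : ℕ) :
    MemLp (ν i t) 4 P := by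
  obtain ⟨C, -, h⟩ := hν.sixth_moment
  exact (h i t).1.mono_exponent (by norm_num)

theorem ErrorAssumption.memLp_two {ν : ℕ → ℕ → Ω → ℝ} (hν : ErrorAssumption P ν) (i t : ℕ) :
    MemLp (ν i t) 2 P :=
  (hν.memLp_four i t).mono_exponent (by norm_num)

theorem ErrorAssumption.exists_moment_le {ν : ℕ → ℕ → Ω → ℝ} (hν : ErrorAssumption P ν) :
    ∃ K > 0, ∀ i t, ∫ ω, ν i t ω ^ 2 ∂P ≤ K ∧ ∫ ω, ν i t ω ^ 4 ∂P ≤ K := by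
  obtain ⟨C, hC, h⟩ := hν.sixth_moment
  have h6 : ∀ i t, Integrable (fun ω => |ν i t ω| ^ 6) P := fun i t => by
    simpa using (h i t).1.integrable_norm_pow (p := 6) (by norm_num)
  refine ⟨1 + C, by positivity, fun i t => ?_⟩
  have hb : ∫ ω, (1 + |ν i t ω| ^ 6) ∂P ≤ 1 + C := by
    rw [integral_add (integrable_const _) (h6 i t)]
    simpa using (h i t).2
  have hpw : ∀ a : ℝ, 0 ≤ a → a ^ 2 ≤ 1 + a ^ 6 ∧ a ^ 4 ≤ 1 + a ^ 6 := fun a ha => by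
    rcases le_total a 1 with h1 | h1
    · have := pow_le_one₀ ha h1 (n := 2)
      have := pow_le_one₀ ha h1 (n := 4)
      have : 0 ≤ a ^ 6 := by positivity
      constructor <;> linarith
    · have := pow_le_pow_right₀ h1 (show 2 ≤ 6 by norm_num)
      have := pow_le_pow_right₀ h1 (show 4 ≤ 6 by norm_num)
      constructor <;> linarith
  have h4 : Integrable (fun ω => ν i t ω ^ 4) P := by
    have := (hν.memLp_four i t).integrable_norm_pow (p := 4) (by norm_num)
    simpa [Even.pow_abs (show Even 4 by decide)] using this
  constructor
  · refine le_trans (integral_mono (hν.memLp_two i t).integrable_sq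
      ((integrable_const _).add (h6 i t)) fun ω => ?_) hb
    simpa using (hpw |ν i t ω| (abs_nonneg _)).1
  · refine le_trans (integral_mono h4 ((integrable_const _).add (h6 i t)) fun ω => ?_) hb
    simpa [Even.pow_abs (show Even 4 by decide)] using (hpw |ν i t ω| (abs_nonneg _)).2

theorem ErrorAssumption.iIndepFun_unit {P : Measure Ω} {ν : ℕ → ℕ → Ω → ℝ} (hν : ErrorAssumption P ν) (i : ℕ) :
    iIndepFun (ν i) P :=
  hν.indep.comp (fun _ f => f i) fun _ => measurable_pi_apply i

/-- The norms of the centred error series are uniformly of order at least `√T`. -/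
theorem ErrorAssumption.exists_tendsto_measure_norm_sq_lt {ν : ℕ → ℕ → Ω → ℝ}
    (hν : ErrorAssumption P ν) (hvar : ∃ σ₀ > 0, ∀ i t, σ₀ ≤ Var[ν i t; P]) {n : ℕ → ℕ} {c : ℝ}
    (hn : Tendsto (fun T : ℕ => (n T : ℝ) / (T : ℝ)) atTop (𝓝 c)) :
    ∃ κ > 0, Tendsto (fun T : ℕ => P {ω | ∃ i : Fin (n T),
      ‖initialSegment T (centred T fun t => ν i t ω)‖ ^ 2 < κ * T}) atTop (𝓝 0) := by
  obtain ⟨σ, hσ0, hσ⟩ := hvar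
  obtain ⟨K, hK0, hK⟩ := hν.exists_moment_le
  refine ⟨σ / 12, by positivity, ?_⟩
  have hlim := ENNReal.tendsto_ofReal
    (tendsto_mul_exp_neg_half hn (δ := σ ^ 2 / (16 * K)) (by positivity))
  rw [ENNReal.ofReal_zero] at hlim
  refine tendsto_of_tendsto_of_tendsto_of_le_of_le' tendsto_const_nhds hlim
    (Eventually.of_forall fun _ => zero_le) ?_
  filter_upwards [eventually_ge_atTop 2] with T hT
  have hone : ∀ i : Fin (n T), P {ω | ‖initialSegment T (centred T fun t => ν i t ω)‖ ^ 2 <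
      σ / 12 * T} ≤ ENNReal.ofReal (Real.exp (-(σ ^ 2 / (16 * K) * ((T / 2 : ℕ) : ℝ)))) :=
    fun i => by
      rw [← ofReal_measureReal]
      refine ENNReal.ofReal_le_ofReal (measureReal_norm_sq_centred_lt_le (hν.measurable i)
        (hν.iIndepFun_unit i) (hν.memLp_four i) (hν.mean_zero i) hσ0 hK0 (fun t => ?_)
        (fun t => (hK i t).2) hT)
      have := hσ i t
      rwa [variance_of_integral_eq_zero (hν.measurable i t).aemeasurable (hν.mean_zero i t)] at this
  rw [Set.ofPred_exists]
  refine (measure_iUnion_fintype_le _ _).trans ((Finset.sum_le_sum fun i _ => hone i).trans ?_)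
  rw [Finset.sum_const, Finset.card_univ, Fintype.card_fin, nsmul_eq_mul,
    ENNReal.ofReal_mul (by positivity), ENNReal.ofReal_natCast]

end LowerTail

/-! ### Isotropy of radial functions of centred i.i.d. series. -/

section Isotropy

/-- Bounded measurable functions. -/
def BddMeasurable {Ω F : Type*} [MeasurableSpace Ω] [NormedAddCommGroup F] [MeasurableSpace F]
    (f : Ω → F) : Prop :=
  Measurable f ∧ ∃ b : ℝ, ∀ ω, ‖f ω‖ ≤ b

namespace BddMeasurable

variable {Ω F τ : Type*} [MeasurableSpace Ω] [NormedAddCommGroup F] [MeasurableSpace F]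
  [Fintype τ]

protected theorem const (c : F) : BddMeasurable fun _ : Ω => c :=
  ⟨measurable_const, ‖c‖, fun _ => le_rfl⟩

protected theorem mul {f g : Ω → ℝ} (hf : BddMeasurable f) (hg : BddMeasurable g) :
    BddMeasurable fun ω => f ω * g ω := by
  obtain ⟨hf, a, ha⟩ := hf
  obtain ⟨hg, b, hb⟩ := hg
  exact ⟨hf.mul hg, a * b, fun ω => (norm_mul_le _ _).trans
    (mul_le_mul (ha ω) (hb ω) (norm_nonneg _) ((norm_nonneg _).trans (ha ω)))⟩

protected theorem sq {f : Ω → ℝ} (hf : BddMeasurable f) : BddMeasurable fun ω => f ω ^ 2 := by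
  simpa only [pow_two] using hf.mul hf

protected theorem abs {f : Ω → ℝ} (hf : BddMeasurable f) : BddMeasurable fun ω => |f ω| := by
  obtain ⟨hf, a, ha⟩ := hf
  exact ⟨by fun_prop, a, fun ω => by simpa using ha ω⟩

protected theorem sum [MeasurableAdd₂ F] {ι : Type*} {f : ι → Ω → F} (s : Finset ι)
    (hf : ∀ i ∈ s, BddMeasurable (f i)) : BddMeasurable fun ω => ∑ i ∈ s, f i ω := by
  classical
  induction s using Finset.induction_on with
  | empty => simpa using BddMeasurable.const (Ω := Ω) (0 : F)
  | insert i s hi ih =>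
    obtain ⟨h1, a, ha⟩ := hf i (Finset.mem_insert_self i s)
    obtain ⟨h2, b, hb⟩ := ih fun j hj => hf j (Finset.mem_insert_of_mem hj)
    simp only [Finset.sum_insert hi]
    exact ⟨h1.add h2, a + b, fun ω => (norm_add_le _ _).trans (add_le_add (ha ω) (hb ω))⟩

protected theorem smul {f : Ω → ℝ} {g : Ω → EuclideanSpace ℝ τ} (hf : BddMeasurable f)
    (hg : BddMeasurable g) : BddMeasurable fun ω => f ω • g ω := by
  obtain ⟨hf, a, ha⟩ := hf
  obtain ⟨hg, b, hb⟩ := hg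
  exact ⟨hf.smul hg, a * b, fun ω => (norm_smul_le _ _).trans
    (mul_le_mul (ha ω) (hb ω) (norm_nonneg _) ((norm_nonneg _).trans (ha ω)))⟩

protected theorem inner {f g : Ω → EuclideanSpace ℝ τ} (hf : BddMeasurable f)
    (hg : BddMeasurable g) : BddMeasurable fun ω => (inner ℝ (f ω) (g ω) : ℝ) := by
  obtain ⟨hf, a, ha⟩ := hf
  obtain ⟨hg, b, hb⟩ := hg
  exact ⟨hf.inner hg, a * b, fun ω => (norm_inner_le_norm _ _).trans
    (mul_le_mul (ha ω) (hb ω) (norm_nonneg _) ((norm_nonneg _).trans (ha ω)))⟩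

protected theorem norm_sq {f : Ω → EuclideanSpace ℝ τ} (hf : BddMeasurable f) :
    BddMeasurable fun ω => ‖f ω‖ ^ 2 := by
  simpa only [real_inner_self_eq_norm_sq] using hf.inner hf

protected theorem apply {f : Ω → EuclideanSpace ℝ τ} (hf : BddMeasurable f) (t : τ) :
    BddMeasurable fun ω => f ω t := by
  obtain ⟨hf, a, ha⟩ := hf
  exact ⟨by fun_prop, a, fun ω => (PiLp.norm_apply_le _ _).trans (ha ω)⟩

protected theorem integrable {P : Measure Ω} [IsFiniteMeasure P] {f : Ω → ℝ}
    (hf : BddMeasurable f) : Integrable f P := by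
  obtain ⟨hf, a, ha⟩ := hf
  exact Integrable.of_bound hf.aestronglyMeasurable a (ae_of_all _ ha)

end BddMeasurable

variable {Ω τ : Type*} [MeasurableSpace Ω] [Fintype τ] {P : Measure Ω} [IsProbabilityMeasure P]

/-- The random vector `X` has coordinate sum zero and second moment matrix `q (I - J / |τ|)`,
`J` being the matrix of ones. -/
structure IsotropicCentred [DecidableEq τ] (P : Measure Ω) (X : Ω → EuclideanSpace ℝ τ) (q : ℝ) :
    Prop where
  bdd : BddMeasurable X
  sum_eq_zero : ∀ ω, ∑ t, X ω t = 0
  integral_mul : ∀ s t, ∫ ω, X ω s * X ω t ∂P =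
    q * ((if s = t then 1 else 0) - (Fintype.card τ : ℝ)⁻¹)

variable [DecidableEq τ]

/-- Given `(B, B')`, the mean is `q Bᵀ (I - J/|τ|) B'`, and `J B' = 0`. It is enough that one of the
two vectors has coordinate sum zero. -/
theorem IsotropicCentred.integral_inner_mul_inner {X B B' : Ω → EuclideanSpace ℝ τ} {q : ℝ}
    (hX : IsotropicCentred P X q) (hB : BddMeasurable B) (hB' : BddMeasurable B')
    (hind : IndepFun X (fun ω => (B ω, B' ω)) P) (hsum : ∀ ω, ∑ t, B' ω t = 0) :
    ∫ ω, inner ℝ (X ω) (B ω) * inner ℝ (X ω) (B' ω) ∂P = q * ∫ ω, inner ℝ (B ω) (B' ω) ∂P := by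
  have h1 : ∀ ω, inner ℝ (X ω) (B ω) * inner ℝ (X ω) (B' ω) =
      ∑ s, ∑ t, (X ω s * X ω t) * (B ω s * B' ω t) := fun ω => by
    rw [inner_eq_sum_mul, inner_eq_sum_mul, Finset.sum_mul_sum]
    exact Finset.sum_congr rfl fun s _ => Finset.sum_congr rfl fun t _ => by ring
  have hXX : ∀ s t, BddMeasurable fun ω => X ω s * X ω t := fun s t =>
    (hX.bdd.apply s).mul (hX.bdd.apply t)
  have hBB : ∀ s t, BddMeasurable fun ω => B ω s * B' ω t := fun s t =>
    (hB.apply s).mul (hB'.apply t)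
  have h2 : ∀ s t, ∫ ω, (X ω s * X ω t) * (B ω s * B' ω t) ∂P =
      q * ((if s = t then 1 else 0) - (Fintype.card τ : ℝ)⁻¹) * ∫ ω, B ω s * B' ω t ∂P :=
    fun s t => by
      rw [← hX.integral_mul s t]
      have h := hind.comp (φ := fun v : EuclideanSpace ℝ τ => v s * v t)
        (ψ := fun v : EuclideanSpace ℝ τ × EuclideanSpace ℝ τ => v.1 s * v.2 t)
        (by fun_prop) (by fun_prop)
      exact h.integral_fun_mul_eq_mul_integral (hXX s t).1.aestronglyMeasurable
        (hBB s t).1.aestronglyMeasurable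
  simp only [h1]
  rw [integral_finsetSum _ fun s _ => (BddMeasurable.sum _ fun t _ =>
    (hXX s t).mul (hBB s t)).integrable]
  have h3 : ∀ s, ∫ ω, ∑ t, (X ω s * X ω t) * (B ω s * B' ω t) ∂P =
      q * ∫ ω, B ω s * B' ω s ∂P := fun s => by
    rw [integral_finsetSum _ fun t _ => ((hXX s t).mul (hBB s t)).integrable]
    have h4 : ∑ t, ∫ ω, B ω s * B' ω t ∂P = 0 := by
      rw [← integral_finsetSum _ fun t _ => (hBB s t).integrable]
      simp [← Finset.mul_sum, hsum]
    simp only [h2, mul_sub, sub_mul, Finset.sum_sub_distrib]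
    rw [← Finset.mul_sum, h4]
    simp
  simp only [h3]
  rw [← Finset.mul_sum, ← integral_finsetSum _ fun s _ => (hBB s s).integrable]
  simp only [inner_eq_sum_mul]

theorem IsotropicCentred.integral_inner_sq {X B : Ω → EuclideanSpace ℝ τ} {q : ℝ}
    (hX : IsotropicCentred P X q) (hB : BddMeasurable B)
    (hind : IndepFun X B P) (hsum : ∀ ω, ∑ t, B ω t = 0) :
    ∫ ω, inner ℝ (X ω) (B ω) ^ 2 ∂P = q * ∫ ω, ‖B ω‖ ^ 2 ∂P := by
  simp only [pow_two, ← real_inner_self_eq_norm_mul_norm]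
  exact hX.integral_inner_mul_inner hB hB
    (hind.comp (φ := id) (ψ := fun v => (v, v)) measurable_id (by fun_prop)) hsum

theorem IsotropicCentred.integral_inner_const_sq {X : Ω → EuclideanSpace ℝ τ} {q : ℝ}
    (hX : IsotropicCentred P X q) {w : EuclideanSpace ℝ τ} (hw : ∑ t, w t = 0) :
    ∫ ω, inner ℝ (X ω) w ^ 2 ∂P = q * ‖w‖ ^ 2 := by
  rw [hX.integral_inner_sq (BddMeasurable.const w) (indepFun_const_right _ _) fun _ => hw]
  simp

/-- A vector with coordinate sum zero whose second moments are invariant under transpositions of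
the coordinates is isotropic. -/
theorem isotropicCentred_of_swap {X : Ω → EuclideanSpace ℝ τ} (hτ : 1 < Fintype.card τ)
    (hX : BddMeasurable X) (hsum : ∀ ω, ∑ t, X ω t = 0)
    (hswap : ∀ a b s t, ∫ ω, X ω (Equiv.swap a b s) * X ω (Equiv.swap a b t) ∂P =
      ∫ ω, X ω s * X ω t ∂P) :
    IsotropicCentred P X ((∫ ω, ‖X ω‖ ^ 2 ∂P) / ((Fintype.card τ : ℝ) - 1)) := by
  refine ⟨hX, hsum, ?_⟩
  have hXX : ∀ s t, Integrable (fun ω => X ω s * X ω t) P := fun s t =>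
    ((hX.apply s).mul (hX.apply t)).integrable
  have hN : (1 : ℝ) < Fintype.card τ := by exact_mod_cast hτ
  have hN1 : (Fintype.card τ : ℝ) - 1 ≠ 0 := by linarith
  have hdiag : ∀ s t, ∫ ω, X ω s * X ω s ∂P = ∫ ω, X ω t * X ω t ∂P := fun s t => by
    have := hswap s t s s
    rw [Equiv.swap_apply_left] at this
    exact this.symm
  have hoff : ∀ s t t', t ≠ s → t' ≠ s →
      ∫ ω, X ω s * X ω t' ∂P = ∫ ω, X ω s * X ω t ∂P := fun s t t' h h' => by
    have := hswap t t' s t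
    rwa [Equiv.swap_apply_left, Equiv.swap_apply_of_ne_of_ne h.symm h'.symm] at this
  have hnorm : ∀ s, ∫ ω, ‖X ω‖ ^ 2 ∂P = Fintype.card τ * ∫ ω, X ω s * X ω s ∂P := fun s => by
    have : ∀ ω, ‖X ω‖ ^ 2 = ∑ t, X ω t * X ω t := fun ω => by
      rw [← real_inner_self_eq_norm_sq, inner_eq_sum_mul]
    simp only [this]
    rw [integral_finsetSum _ fun t _ => hXX t t, Finset.sum_congr rfl fun t _ => hdiag t s]
    simp
  intro s t
  rw [hnorm s]
  rcases eq_or_ne s t with rfl | hst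
  · simp only [if_true]
    field_simp
  -- Each row of the second moment matrix sums to zero, so the common diagonal entry determines the
  -- common off-diagonal one.
  · have h0 : ∑ t', ∫ ω, X ω s * X ω t' ∂P = 0 := by
      rw [← integral_finsetSum _ fun t _ => hXX s t]
      simp [← Finset.mul_sum, hsum]
    rw [← Finset.add_sum_erase _ _ (Finset.mem_univ s), Finset.sum_congr rfl fun t' ht' =>
      hoff s t t' hst.symm (Finset.ne_of_mem_erase ht'), Finset.sum_const,
      Finset.card_erase_of_mem (Finset.mem_univ s), Finset.card_univ, nsmul_eq_mul,
      Nat.cast_sub hτ.le] at h0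
    rw [if_neg hst]
    push_cast at h0
    generalize ∫ ω, X ω s * X ω s ∂P = m at *
    generalize ∫ ω, X ω s * X ω t ∂P = m' at *
    have hN0 : (Fintype.card τ : ℝ) ≠ 0 := by linarith
    field_simp
    linarith

/-- The vector `f` centred at its mean. -/
noncomputable def centredVec {T : ℕ} (f : Fin T → ℝ) : EuclideanSpace ℝ (Fin T) :=
  WithLp.toLp 2 fun t => f t - (T : ℝ)⁻¹ * ∑ s, f s

theorem initialSegment_centred (T : ℕ) (z : ℕ → ℝ) :
    initialSegment T (centred T z) = centredVec fun t : Fin T => z t := by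
  ext t
  simp [centred, centredVec, Finset.sum_range]

theorem measurable_centredVec (T : ℕ) : Measurable (centredVec (T := T)) := by
  unfold centredVec
  fun_prop

theorem sum_centredVec {T : ℕ} (f : Fin T → ℝ) : ∑ t, centredVec f t = 0 := by
  rcases Nat.eq_zero_or_pos T with rfl | hT
  · simp
  · have : (T : ℝ) ≠ 0 := by positivity
    simp [centredVec, Finset.sum_sub_distrib, this]

theorem centredVec_comp_perm {T : ℕ} (f : Fin T → ℝ) (σ : Equiv.Perm (Fin T)) (t : Fin T) :
    centredVec (fun s => f (σ s)) t = centredVec f (σ t) := by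
  simp [centredVec, Equiv.sum_comp σ f]

theorem norm_centredVec_comp_perm {T : ℕ} (f : Fin T → ℝ) (σ : Equiv.Perm (Fin T)) :
    ‖centredVec fun s => f (σ s)‖ = ‖centredVec f‖ := by
  simp only [EuclideanSpace.norm_eq, centredVec_comp_perm]
  rw [Equiv.sum_comp σ fun t => ‖centredVec f t‖ ^ 2]

/-- Both laws are the product of copies of the law of `z 0`. -/
theorem map_comp_perm_eq {P : Measure Ω} {z : ℕ → Ω → ℝ} (hz : ∀ t, Measurable (z t))
    (hind : iIndepFun z P) (hid : ∀ t, IdentDistrib (z t) (z 0) P P) {T : ℕ}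
    (σ : Equiv.Perm (Fin T)) :
    P.map (fun ω (t : Fin T) => z (σ t) ω) = P.map (fun ω (t : Fin T) => z t ω) := by
  have h : ∀ σ : Equiv.Perm (Fin T), P.map (fun ω (t : Fin T) => z (σ t) ω) =
      Measure.pi fun _ : Fin T => P.map (z 0) := fun σ => by
    rw [(hind.precomp (g := fun t : Fin T => (σ t : ℕ))
      (Fin.val_injective.comp σ.injective)).map_fun_eq_pi_map fun t => (hz _).aemeasurable]
    congr 1
    ext1 t
    exact (hid _).map_eq
  rw [h σ]
  exact (h (Equiv.refl _)).symm

/-- Radial functions of centred i.i.d. series are isotropic. -/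
theorem isotropicCentred_smul_centredVec {z : ℕ → Ω → ℝ} (hz : ∀ t, Measurable (z t))
    (hind : iIndepFun z P) (hid : ∀ t, IdentDistrib (z t) (z 0) P P) {T : ℕ} (hT : 1 < T)
    {φ : ℝ → ℝ} (hφ : Measurable φ) {b : ℝ}
    (hb : ∀ v : EuclideanSpace ℝ (Fin T), ‖φ ‖v‖ • v‖ ≤ b) :
    ∃ q ≤ b ^ 2 / ((T : ℝ) - 1), IsotropicCentred P
      (fun ω => φ ‖centredVec fun t : Fin T => z t ω‖ • centredVec fun t : Fin T => z t ω) q := by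
  have hv : Measurable fun ω => centredVec fun t : Fin T => z t ω :=
    (measurable_centredVec T).comp (measurable_pi_lambda _ fun t => hz t)
  have hX : BddMeasurable fun ω =>
      φ ‖centredVec fun t : Fin T => z t ω‖ • centredVec fun t : Fin T => z t ω :=
    ⟨by fun_prop, b, fun ω => hb _⟩
  have hT1 : (0 : ℝ) < (T : ℝ) - 1 := by
    have : (1 : ℝ) < T := by exact_mod_cast hT
    linarith
  have main := isotropicCentred_of_swap (P := P) (by simpa using hT) hX
    (fun ω => by simp [← Finset.mul_sum, sum_centredVec]) fun a c s t => ?_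
  · refine ⟨_, ?_, main⟩
    rw [Fintype.card_fin]
    gcongr
    calc _ ≤ ∫ _, b ^ 2 ∂P := integral_mono hX.norm_sq.integrable (integrable_const _)
          fun ω => pow_le_pow_left₀ (norm_nonneg _) (hb _) 2
      _ = b ^ 2 := by simp
  -- Centring commutes with permutations of time and the norm is invariant, so the radial factor is
  -- unchanged and exchangeability of the series carries over.
  · set G : (Fin T → ℝ) → ℝ := fun f =>
      (φ ‖centredVec f‖ * centredVec f s) * (φ ‖centredVec f‖ * centredVec f t)
    have hG : Measurable G := by
      have := measurable_centredVec T
      fun_prop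
    have h1 : ∫ ω, G (fun r => z (Equiv.swap a c r) ω) ∂P =
        ∫ ω, G (fun r => z r ω) ∂P := by
      rw [← integral_map (φ := fun ω (r : Fin T) => z (Equiv.swap a c r) ω) (f := G)
          (measurable_pi_lambda _ fun r => hz _).aemeasurable hG.aestronglyMeasurable,
        map_comp_perm_eq hz hind hid,
        integral_map (measurable_pi_lambda _ fun r => hz _).aemeasurable hG.aestronglyMeasurable]
    simp only [PiLp.smul_apply, smul_eq_mul]
    refine Eq.trans (integral_congr_ae (ae_of_all _ fun ω => ?_)) h1
    have h2 := norm_centredVec_comp_perm (fun r : Fin T => z r ω) (Equiv.swap a c)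
    have h3 := centredVec_comp_perm (fun r : Fin T => z r ω) (Equiv.swap a c)
    simp only [G, h2, h3]

end Isotropy

/-! ### Moment bounds for independent isotropic vectors. -/

section Moments

variable {Ω τ ι : Type*} [MeasurableSpace Ω] [Fintype τ] [DecidableEq τ]
  {P : Measure Ω} [IsProbabilityMeasure P]

theorem integral_abs_le_sqrt {f : Ω → ℝ} (hf : BddMeasurable f) {b : ℝ}
    (hb : ∫ ω, f ω ^ 2 ∂P ≤ b) : ∫ ω, |f ω| ∂P ≤ √b := by
  apply Real.le_sqrt_of_sq_le
  have h := variance_nonneg (fun ω => |f ω|) P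
  obtain ⟨hm, a, ha⟩ := hf
  have h2 : MemLp (fun ω => |f ω|) 2 P :=
    MemLp.of_bound (by fun_prop) a (ae_of_all _ fun ω => by simpa using ha ω)
  rw [variance_eq_sub h2] at h
  simp only [Pi.pow_apply, sq_abs] at h
  linarith

theorem sum_norm_le_sqrt {τ ι : Type*} [Fintype τ] [Fintype ι] {w : ι → EuclideanSpace ℝ τ} (hw : ∑ i, ‖w i‖ ^ 2 = 1) :
    ∑ i, ‖w i‖ ≤ √(Fintype.card ι) := by
  apply Real.le_sqrt_of_sq_le
  have := sq_sum_le_card_mul_sum_sq (s := Finset.univ) (f := fun i => ‖w i‖)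
  rw [hw, mul_one, Finset.card_univ] at this
  exact this

/-- Independent pairs of isotropic vectors `(e i, u i)` with `‖e i‖ ≤ 1`, the second moments of
`e i` and `u i` in a given direction being at most `ρ` and `p`. -/
structure IsotropicFamily (P : Measure Ω) (e u : ι → Ω → EuclideanSpace ℝ τ) (ρ p : ℝ) :
    Prop where
  indep : iIndepFun (fun i ω => (e i ω, u i ω)) P
  norm_le_one : ∀ i ω, ‖e i ω‖ ≤ 1
  isotropic_left : ∀ i, ∃ q ≤ ρ, IsotropicCentred P (e i) q
  isotropic_right : ∀ i, ∃ q ≤ p, IsotropicCentred P (u i) q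
  nonneg : 0 ≤ ρ

namespace IsotropicFamily

variable {e u : ι → Ω → EuclideanSpace ℝ τ} {ρ p : ℝ}

theorem bdd_left {P : Measure Ω} (h : IsotropicFamily P e u ρ p) (i : ι) : BddMeasurable (e i) := by
  obtain ⟨q, -, hq⟩ := h.isotropic_left i
  exact hq.bdd

theorem bdd_right {P : Measure Ω} (h : IsotropicFamily P e u ρ p) (i : ι) : BddMeasurable (u i) := by
  obtain ⟨q, -, hq⟩ := h.isotropic_right i
  exact hq.bdd

theorem sum_left {P : Measure Ω} (h : IsotropicFamily P e u ρ p) (i : ι) (ω : Ω) : ∑ t, e i ω t = 0 := by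
  obtain ⟨q, -, hq⟩ := h.isotropic_left i
  exact hq.sum_eq_zero ω

theorem indep_left {P : Measure Ω} (h : IsotropicFamily P e u ρ p) {i j : ι} (hij : i ≠ j) :
    IndepFun (e i) (e j) P :=
  (h.indep.indepFun hij).comp measurable_fst measurable_fst

theorem integral_inner_const_sq_le (h : IsotropicFamily P e u ρ p) (i : ι)
    {w : EuclideanSpace ℝ τ} (hw : ∑ t, w t = 0) :
    ∫ ω, inner ℝ (e i ω) w ^ 2 ∂P ≤ ρ * ‖w‖ ^ 2 := by
  obtain ⟨q, hq, hiso⟩ := h.isotropic_left i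
  rw [hiso.integral_inner_const_sq hw]
  gcongr

theorem integral_inner_sq_le (h : IsotropicFamily P e u ρ p) {i j : ι} (hij : i ≠ j) :
    ∫ ω, inner ℝ (e i ω) (e j ω) ^ 2 ∂P ≤ ρ := by
  obtain ⟨q, hq, hiso⟩ := h.isotropic_left i
  rw [hiso.integral_inner_sq (h.bdd_left j) (h.indep_left hij) (h.sum_left j)]
  have h1 : ∫ ω, ‖e j ω‖ ^ 2 ∂P ≤ 1 := by
    calc _ ≤ ∫ _, (1 : ℝ) ∂P := integral_mono (h.bdd_left j).norm_sq.integrable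
          (integrable_const _) fun ω => pow_le_one₀ (norm_nonneg _) (h.norm_le_one j ω)
      _ = 1 := by simp
  have h0 : 0 ≤ ∫ ω, ‖e j ω‖ ^ 2 ∂P := integral_nonneg fun ω => sq_nonneg _
  nlinarith [h.nonneg]

/-- Integrating out `e j` first turns `⟨e i, e j⟩²` into at most `ρ ‖e i‖² ≤ ρ`; what remains is a
first absolute moment of `⟨e i, w⟩`. -/
theorem integral_abs_inner_mul_inner_sq_le (h : IsotropicFamily P e u ρ p) {i j : ι}
    (hij : i ≠ j) {w : EuclideanSpace ℝ τ} (hw : ∑ t, w t = 0) :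
    ∫ ω, |inner ℝ (e i ω) w| * inner ℝ (e i ω) (e j ω) ^ 2 ∂P ≤ ρ * (√ρ * ‖w‖) := by
  obtain ⟨q, hq, hiso⟩ := h.isotropic_left j
  have hb : BddMeasurable fun ω => |inner ℝ (e i ω) w| :=
    ((h.bdd_left i).inner (BddMeasurable.const w)).abs
  have hind : IndepFun (e j) (fun ω => (|inner ℝ (e i ω) w| • e i ω, e i ω)) P :=
    (h.indep_left hij.symm).comp (φ := id)
      (ψ := fun v : EuclideanSpace ℝ τ => (|inner ℝ v w| • v, v)) measurable_id (by fun_prop)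
  have key := hiso.integral_inner_mul_inner (hb.smul (h.bdd_left i)) (h.bdd_left i) hind
    (h.sum_left i)
  have h1 : ∀ ω, inner ℝ (e j ω) (|inner ℝ (e i ω) w| • e i ω) * inner ℝ (e j ω) (e i ω) =
      |inner ℝ (e i ω) w| * inner ℝ (e i ω) (e j ω) ^ 2 := fun ω => by
    rw [real_inner_smul_right, real_inner_comm (e i ω) (e j ω)]
    ring
  simp only [h1] at key
  rw [key]
  have h2 : ∫ ω, inner ℝ (|inner ℝ (e i ω) w| • e i ω) (e i ω) ∂P ≤
      ∫ ω, |inner ℝ (e i ω) w| ∂P := by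
    refine integral_mono ((hb.smul (h.bdd_left i)).inner (h.bdd_left i)).integrable
      hb.integrable fun ω => ?_
    simp only
    rw [real_inner_smul_left, real_inner_self_eq_norm_sq]
    exact mul_le_of_le_one_right (abs_nonneg _) (pow_le_one₀ (norm_nonneg _) (h.norm_le_one i ω))
  have h3 : ∫ ω, |inner ℝ (e i ω) w| ∂P ≤ √ρ * ‖w‖ := by
    have := integral_abs_le_sqrt ((h.bdd_left i).inner (BddMeasurable.const w))
      (h.integral_inner_const_sq_le i hw)
    rwa [Real.sqrt_mul h.nonneg, Real.sqrt_sq (norm_nonneg _)] at this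
  have h0 : 0 ≤ ∫ ω, inner ℝ (|inner ℝ (e i ω) w| • e i ω) (e i ω) ∂P :=
    integral_nonneg fun ω => by
      simp only [real_inner_smul_left, real_inner_self_eq_norm_sq]
      positivity
  calc _ ≤ ρ * ∫ ω, inner ℝ (|inner ℝ (e i ω) w| • e i ω) (e i ω) ∂P :=
        mul_le_mul_of_nonneg_right hq h0
    _ ≤ _ := mul_le_mul_of_nonneg_left (h2.trans h3) h.nonneg

/-- In the expanded square a diagonal term is at most `⟨e j, w⟩²`. For `j ≠ l`, integrating out `e
l` leaves a multiple of `⟨e j, w⟩²` with factor at most `ρ`, hence mean at most `ρ² ‖w‖²`. -/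
theorem integral_norm_sq_sum_inner_smul_le (h : IsotropicFamily P e u ρ p) (s : Finset ι)
    {w : EuclideanSpace ℝ τ} (hw : ∑ t, w t = 0) :
    ∫ ω, ‖∑ j ∈ s, inner ℝ (e j ω) w • e j ω‖ ^ 2 ∂P ≤
      (s.card * ρ + (s.card * ρ) ^ 2) * ‖w‖ ^ 2 := by
  classical
  have hew : ∀ j, BddMeasurable fun ω => (inner ℝ (e j ω) w : ℝ) := fun j =>
    (h.bdd_left j).inner (BddMeasurable.const w)
  have hterm : ∀ j l, BddMeasurable fun ω =>
      inner ℝ (e j ω) w * (inner ℝ (e l ω) w * inner ℝ (e j ω) (e l ω)) := fun j l =>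
    (hew j).mul ((hew l).mul ((h.bdd_left j).inner (h.bdd_left l)))
  have h1 : ∀ ω, ‖∑ j ∈ s, inner ℝ (e j ω) w • e j ω‖ ^ 2 =
      ∑ j ∈ s, ∑ l ∈ s, inner ℝ (e j ω) w * (inner ℝ (e l ω) w * inner ℝ (e j ω) (e l ω)) :=
    fun ω => by
      rw [← real_inner_self_eq_norm_sq, sum_inner]
      refine Finset.sum_congr rfl fun j _ => ?_
      rw [inner_sum]
      refine Finset.sum_congr rfl fun l _ => ?_
      rw [real_inner_smul_left, real_inner_smul_right]
  have h2 : ∀ j l, ∫ ω, inner ℝ (e j ω) w * (inner ℝ (e l ω) w * inner ℝ (e j ω) (e l ω)) ∂P ≤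
      (if j = l then ρ * ‖w‖ ^ 2 else 0) + ρ ^ 2 * ‖w‖ ^ 2 := fun j l => by
    rcases eq_or_ne j l with rfl | hjl
    · rw [if_pos rfl]
      have : ∫ ω, inner ℝ (e j ω) w * (inner ℝ (e j ω) w * inner ℝ (e j ω) (e j ω)) ∂P ≤
          ∫ ω, inner ℝ (e j ω) w ^ 2 ∂P := by
        refine integral_mono (hterm j j).integrable (hew j).sq.integrable fun ω => ?_
        simp only
        rw [← mul_assoc, ← pow_two, real_inner_self_eq_norm_sq]
        exact mul_le_of_le_one_right (sq_nonneg _)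
          (pow_le_one₀ (norm_nonneg _) (h.norm_le_one j ω))
      have := h.integral_inner_const_sq_le j hw
      have : 0 ≤ ρ ^ 2 * ‖w‖ ^ 2 := by positivity
      linarith
    · rw [if_neg hjl, zero_add]
      obtain ⟨q, hq, hiso⟩ := h.isotropic_left l
      have hind : IndepFun (e l) (fun ω => (inner ℝ (e j ω) w • e j ω, w)) P :=
        (h.indep_left hjl.symm).comp (φ := id)
          (ψ := fun v : EuclideanSpace ℝ τ => ((inner ℝ v w : ℝ) • v, w)) measurable_id
          (by fun_prop)
      have key := hiso.integral_inner_mul_inner ((hew j).smul (h.bdd_left j))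
        (BddMeasurable.const w) hind fun _ => hw
      have e1 : ∀ ω, inner ℝ (e l ω) ((inner ℝ (e j ω) w : ℝ) • e j ω) * inner ℝ (e l ω) w =
          inner ℝ (e j ω) w * (inner ℝ (e l ω) w * inner ℝ (e j ω) (e l ω)) := fun ω => by
        rw [real_inner_smul_right, real_inner_comm (e j ω) (e l ω)]
        ring
      have e2 : ∀ ω, inner ℝ ((inner ℝ (e j ω) w : ℝ) • e j ω) w = inner ℝ (e j ω) w ^ 2 :=
        fun ω => by rw [real_inner_smul_left, pow_two]
      simp only [e1, e2] at key
      rw [key]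
      have h3 := h.integral_inner_const_sq_le j hw
      have h0 : 0 ≤ ∫ ω, inner ℝ (e j ω) w ^ 2 ∂P := integral_nonneg fun ω => sq_nonneg _
      calc _ ≤ ρ * ∫ ω, inner ℝ (e j ω) w ^ 2 ∂P := mul_le_mul_of_nonneg_right hq h0
        _ ≤ ρ * (ρ * ‖w‖ ^ 2) := mul_le_mul_of_nonneg_left h3 h.nonneg
        _ = _ := by ring
  simp only [h1]
  rw [integral_finsetSum _ fun j _ => (BddMeasurable.sum _ fun l _ => hterm j l).integrable]
  calc _ ≤ ∑ j ∈ s, ∑ l ∈ s, ((if j = l then ρ * ‖w‖ ^ 2 else 0) + ρ ^ 2 * ‖w‖ ^ 2) := by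
        refine Finset.sum_le_sum fun j _ => ?_
        rw [integral_finsetSum _ fun l _ => (hterm j l).integrable]
        exact Finset.sum_le_sum fun l _ => h2 j l
    _ = _ := by
        simp only [Finset.sum_add_distrib, Finset.sum_ite_eq, Finset.sum_ite_mem,
          Finset.inter_self, Finset.sum_const, nsmul_eq_mul]
        ring

variable [Fintype ι] [DecidableEq ι]

theorem bdd_sum_inner_mul_inner {P : Measure Ω} (h : IsotropicFamily P e u ρ p) (i : ι)
    (w : EuclideanSpace ℝ τ) : BddMeasurable fun ω =>
      ∑ j ∈ Finset.univ.erase i, inner ℝ (u i ω) (e j ω) * inner ℝ (e j ω) w :=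
  BddMeasurable.sum _ fun j _ =>
    ((h.bdd_right i).inner (h.bdd_left j)).mul ((h.bdd_left j).inner (BddMeasurable.const w))

/-- The sum is `⟨u i, B⟩` with `B = ∑_{j≠i} ⟨e j, w⟩ e j` independent of `u i`, so isotropy bounds
its second moment by `p E‖B‖²`. Taking absolute values term by term instead would lose a factor of
order `√T`, and the first-order term would not vanish. -/
theorem integral_abs_sum_inner_mul_inner_le (h : IsotropicFamily P e u ρ p) (hp : 0 ≤ p) (i : ι)
    {w : EuclideanSpace ℝ τ} (hw : ∑ t, w t = 0) :
    ∫ ω, |∑ j ∈ Finset.univ.erase i, inner ℝ (u i ω) (e j ω) * inner ℝ (e j ω) w| ∂P ≤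
      √(p * (Fintype.card ι * ρ + (Fintype.card ι * ρ) ^ 2)) * ‖w‖ := by
  obtain ⟨q, hq, hiso⟩ := h.isotropic_right i
  set s : Finset ι := Finset.univ.erase i with hs
  set B : Ω → EuclideanSpace ℝ τ := fun ω => ∑ j ∈ s, inner ℝ (e j ω) w • e j ω with hBdef
  have hB : BddMeasurable B := BddMeasurable.sum _ fun j _ =>
    ((h.bdd_left j).inner (BddMeasurable.const w)).smul (h.bdd_left j)
  have h1 : ∀ ω, ∑ j ∈ s, inner ℝ (u i ω) (e j ω) * inner ℝ (e j ω) w =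
      inner ℝ (u i ω) (B ω) := fun ω => by
    rw [hBdef, inner_sum]
    refine Finset.sum_congr rfl fun j _ => ?_
    rw [real_inner_smul_right, mul_comm]
  have hind : IndepFun (u i) B P := by
    have h2 := h.indep.indepFun_finset {i} s (by simp [hs])
      fun j => (h.bdd_left j).1.prodMk (h.bdd_right j).1
    have h3 := h2.comp
      (φ := fun f : (({i} : Finset ι) → EuclideanSpace ℝ τ × EuclideanSpace ℝ τ) =>
        (f ⟨i, by simp⟩).2)
      (ψ := fun f : (s → EuclideanSpace ℝ τ × EuclideanSpace ℝ τ) =>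
        ∑ j, (inner ℝ (f j).1 w : ℝ) • (f j).1) (by fun_prop) (by fun_prop)
    have h4 : B = fun ω => ∑ j : s, (inner ℝ (e j ω) w : ℝ) • e j ω := by
      ext1 ω
      rw [hBdef]
      exact (Finset.sum_coe_sort s fun j => (inner ℝ (e j ω) w : ℝ) • e j ω).symm
    rw [h4]
    exact h3
  have hsumB : ∀ ω, ∑ t, B ω t = 0 := fun ω => by
    simp only [hBdef, WithLp.ofLp_sum, Finset.sum_apply, PiLp.smul_apply, smul_eq_mul]
    rw [Finset.sum_comm]
    exact Finset.sum_eq_zero fun j _ => by rw [← Finset.mul_sum, h.sum_left, mul_zero]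
  simp only [h1]
  have hcard : (s.card : ℝ) ≤ Fintype.card ι := by exact_mod_cast Finset.card_le_univ s
  have hsq : ∫ ω, inner ℝ (u i ω) (B ω) ^ 2 ∂P ≤
      p * (Fintype.card ι * ρ + (Fintype.card ι * ρ) ^ 2) * ‖w‖ ^ 2 := by
    rw [hiso.integral_inner_sq hB hind hsumB]
    have h0 : 0 ≤ ∫ ω, ‖B ω‖ ^ 2 ∂P := integral_nonneg fun ω => sq_nonneg _
    have h5 := h.integral_norm_sq_sum_inner_smul_le s hw
    have h6 := h.nonneg
    calc _ ≤ p * ∫ ω, ‖B ω‖ ^ 2 ∂P := mul_le_mul_of_nonneg_right hq h0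
      _ ≤ p * ((s.card * ρ + (s.card * ρ) ^ 2) * ‖w‖ ^ 2) := mul_le_mul_of_nonneg_left h5 hp
      _ ≤ p * ((Fintype.card ι * ρ + (Fintype.card ι * ρ) ^ 2) * ‖w‖ ^ 2) := by gcongr
      _ = _ := by ring
  refine (integral_abs_le_sqrt ((h.bdd_right i).inner hB) hsq).trans ?_
  rw [Real.sqrt_mul (by have := h.nonneg; positivity), Real.sqrt_sq (norm_nonneg _)]

theorem integral_sum_inner_const_sq_le (h : IsotropicFamily P e u ρ p)
    {w : ι → EuclideanSpace ℝ τ} (hw : ∑ i, ‖w i‖ ^ 2 = 1) (hw0 : ∀ i, ∑ t, w i t = 0) :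
    ∫ ω, ∑ i, ∑ j ∈ Finset.univ.erase i, inner ℝ (e j ω) (w i) ^ 2 ∂P ≤
      Fintype.card ι * ρ := by
  have hb : ∀ i j, BddMeasurable fun ω => (inner ℝ (e j ω) (w i) : ℝ) ^ 2 := fun i j =>
    ((h.bdd_left j).inner (BddMeasurable.const _)).sq
  rw [integral_finsetSum _ fun i _ => (BddMeasurable.sum _ fun j _ => hb i j).integrable]
  calc _ ≤ ∑ i, (Fintype.card ι * ρ) * ‖w i‖ ^ 2 := by
        refine Finset.sum_le_sum fun i _ => ?_
        rw [integral_finsetSum _ fun j _ => (hb i j).integrable]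
        refine (Finset.sum_le_sum fun j _ => h.integral_inner_const_sq_le j (hw0 i)).trans ?_
        rw [Finset.sum_const, nsmul_eq_mul, ← mul_assoc]
        have := h.nonneg
        gcongr
        exact Finset.card_le_univ _
    _ = _ := by rw [← Finset.mul_sum, hw, mul_one]

theorem bdd_sum_inner_sq {P : Measure Ω} (h : IsotropicFamily P e u ρ p) (i : ι) :
    BddMeasurable fun ω => ∑ j ∈ Finset.univ.erase i, (inner ℝ (e i ω) (e j ω) : ℝ) ^ 2 :=
  BddMeasurable.sum _ fun j _ => ((h.bdd_left i).inner (h.bdd_left j)).sq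

theorem integral_sum_inner_sq_le (h : IsotropicFamily P e u ρ p) (i : ι) :
    ∫ ω, ∑ j ∈ Finset.univ.erase i, inner ℝ (e i ω) (e j ω) ^ 2 ∂P ≤ Fintype.card ι * ρ := by
  rw [integral_finsetSum _ fun j _ => ((h.bdd_left i).inner (h.bdd_left j)).sq.integrable]
  refine (Finset.sum_le_sum fun j hj =>
    h.integral_inner_sq_le (Finset.ne_of_mem_erase hj).symm).trans ?_
  rw [Finset.sum_const, nsmul_eq_mul]
  have := h.nonneg
  gcongr
  exact Finset.card_le_univ _

theorem integral_sum_sum_inner_sq_le (h : IsotropicFamily P e u ρ p) :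
    ∫ ω, ∑ i, ∑ j ∈ Finset.univ.erase i, inner ℝ (e i ω) (e j ω) ^ 2 ∂P ≤
      Fintype.card ι * (Fintype.card ι * ρ) := by
  rw [integral_finsetSum _ fun i _ => (h.bdd_sum_inner_sq i).integrable]
  refine (Finset.sum_le_sum fun i _ => h.integral_sum_inner_sq_le i).trans ?_
  rw [Finset.sum_const, nsmul_eq_mul, Finset.card_univ]

theorem integral_sum_norm_sq_mul_sum_inner_sq_le (h : IsotropicFamily P e u ρ p)
    {w : ι → EuclideanSpace ℝ τ} (hw : ∑ i, ‖w i‖ ^ 2 = 1) :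
    ∫ ω, ∑ i, ‖w i‖ ^ 2 * ∑ j ∈ Finset.univ.erase i, inner ℝ (e i ω) (e j ω) ^ 2 ∂P ≤
      Fintype.card ι * ρ := by
  rw [integral_finsetSum _ fun i _ => (h.bdd_sum_inner_sq i).integrable.const_mul _]
  simp only [integral_const_mul]
  refine (Finset.sum_le_sum fun i _ =>
    mul_le_mul_of_nonneg_left (h.integral_sum_inner_sq_le i) (sq_nonneg _)).trans ?_
  rw [← Finset.sum_mul, hw, one_mul]

theorem integral_sum_abs_inner_mul_sum_inner_sq_le (h : IsotropicFamily P e u ρ p)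
    {w : ι → EuclideanSpace ℝ τ} (hw : ∑ i, ‖w i‖ ^ 2 = 1) (hw0 : ∀ i, ∑ t, w i t = 0) :
    ∫ ω, ∑ i, |inner ℝ (e i ω) (w i)| *
        ∑ j ∈ Finset.univ.erase i, inner ℝ (e i ω) (e j ω) ^ 2 ∂P ≤
      Fintype.card ι * ρ * √(Fintype.card ι * ρ) := by
  have hb : ∀ i j, BddMeasurable fun ω =>
      |inner ℝ (e i ω) (w i)| * (inner ℝ (e i ω) (e j ω) : ℝ) ^ 2 := fun i j =>
    ((h.bdd_left i).inner (BddMeasurable.const _)).abs.mul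
      ((h.bdd_left i).inner (h.bdd_left j)).sq
  simp only [Finset.mul_sum]
  rw [integral_finsetSum _ fun i _ => (BddMeasurable.sum _ fun j _ => hb i j).integrable]
  have hρ := h.nonneg
  calc _ ≤ ∑ i, (Fintype.card ι * ρ * √ρ) * ‖w i‖ := by
        refine Finset.sum_le_sum fun i _ => ?_
        rw [integral_finsetSum _ fun j _ => (hb i j).integrable]
        refine (Finset.sum_le_sum fun j hj => h.integral_abs_inner_mul_inner_sq_le
          (Finset.ne_of_mem_erase hj).symm (hw0 i)).trans ?_
        rw [Finset.sum_const, nsmul_eq_mul]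
        calc _ ≤ (Fintype.card ι : ℝ) * (ρ * (√ρ * ‖w i‖)) := by
              gcongr
              exact Finset.card_le_univ _
          _ = _ := by ring
    _ ≤ (Fintype.card ι * ρ * √ρ) * √(Fintype.card ι) := by
        rw [← Finset.mul_sum]
        gcongr
        exact sum_norm_le_sqrt hw
    _ = _ := by rw [Real.sqrt_mul (by positivity)]; ring

theorem integral_sum_abs_sum_inner_mul_inner_le (h : IsotropicFamily P e u ρ p) (hp : 0 ≤ p)
    {w : ι → EuclideanSpace ℝ τ} (hw : ∑ i, ‖w i‖ ^ 2 = 1) (hw0 : ∀ i, ∑ t, w i t = 0) :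
    ∫ ω, ∑ i, |∑ j ∈ Finset.univ.erase i,
        inner ℝ (u i ω) (e j ω) * inner ℝ (e j ω) (w i)| ∂P ≤
      √(p * (Fintype.card ι * ρ + (Fintype.card ι * ρ) ^ 2)) * √(Fintype.card ι) := by
  rw [integral_finsetSum _ fun i _ => (h.bdd_sum_inner_mul_inner i (w i)).abs.integrable]
  refine (Finset.sum_le_sum fun i _ =>
    h.integral_abs_sum_inner_mul_inner_le hp i (hw0 i)).trans ?_
  rw [← Finset.mul_sum]
  gcongr
  exact sum_norm_le_sqrt hw

end IsotropicFamily

end Moments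

/-! ### Deterministic bound of the trace difference by the control statistics. -/

section Perturbation

variable {E ι κ : Type*} [NormedAddCommGroup E] [InnerProductSpace ℝ E] [Fintype ι]
  [DecidableEq ι] [Fintype κ]

/-- The statistics of the error vectors that control the effect of a perturbation by
`∑ a, ξ a • w a i`, on the scale `r`. -/
noncomputable def perturbationControl (r : ℝ) (w : κ → ι → E) (e u : ι → E) (ξ : κ → ℝ) : ℝ :=
  ∑ a, ξ a ^ 2
    + ∑ a, ∑ i, ∑ j ∈ Finset.univ.erase i, inner ℝ (e j) (w a i) ^ 2
    + r * ∑ a, ∑ i, |∑ j ∈ Finset.univ.erase i, inner ℝ (u i) (e j) * inner ℝ (e j) (w a i)|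
    + (r ^ 2)⁻¹ * ∑ i, ∑ j ∈ Finset.univ.erase i, inner ℝ (e i) (e j) ^ 2
    + ∑ a, ∑ i, ‖w a i‖ ^ 2 * ∑ j ∈ Finset.univ.erase i, inner ℝ (e i) (e j) ^ 2
    + ∑ a, ∑ i, |inner ℝ (e i) (w a i)| * ∑ j ∈ Finset.univ.erase i, inner ℝ (e i) (e j) ^ 2

/-- The constant in the perturbation bound for `k` regressors when the control is at most `L` and
the squared norms of the vectors are at least `c r ^ 2`. -/
noncomputable def perturbationConst (k c L : ℝ) : ℝ :=
  L ^ 2 / c + L * k / c + L ^ 2 + (L + (L * k / c) ^ 2) / 2 + (L ^ 2 / √c + L ^ 2 / c)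

theorem sq_sum_mul_le (f g : κ → ℝ) : (∑ a, f a * g a) ^ 2 ≤ (∑ a, f a ^ 2) * ∑ a, g a ^ 2 :=
  Finset.sum_mul_sq_le_sq_mul_sq _ _ _

theorem norm_sq_sum_smul_le (f : κ → ℝ) (w : κ → E) :
    ‖∑ a, f a • w a‖ ^ 2 ≤ (∑ a, f a ^ 2) * ∑ a, ‖w a‖ ^ 2 := by
  refine le_trans ?_ ((Finset.sum_mul_sq_le_sq_mul_sq Finset.univ (fun a => |f a|)
    fun a => ‖w a‖).trans_eq (by simp only [sq_abs]))
  refine pow_le_pow_left₀ (norm_nonneg _) ((norm_sum_le _ _).trans_eq ?_) 2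
  simp only [norm_smul, Real.norm_eq_abs]

set_option maxHeartbeats 1000000 in
/-- Stability of the sum of the squared correlations of the vectors `v i` under the perturbation
by `∑ a, ξ a • w a i`. -/
theorem abs_sum_sq_inner_unitVec_sub_sum_smul_le {r c L : ℝ} (hr : 1 ≤ r) (hc : 0 < c)
    (hL : 1 ≤ L) {v e u : ι → E} {w : κ → ι → E} {ξ : κ → ℝ}
    (he : ∀ i, e i = unitVec (v i)) (hu : ∀ i, u i = (‖v i‖ ^ 2)⁻¹ • v i)
    (hv : ∀ i, c * r ^ 2 ≤ ‖v i‖ ^ 2) (hw : ∀ a, ∑ i, ‖w a i‖ ^ 2 = 1)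
    (hW : perturbationControl r w e u ξ ≤ L)
    (hsmall : perturbationConst (Fintype.card κ) c L / r ≤ 1 / 16) :
    |∑ i, ∑ j, inner ℝ (unitVec (v i - ∑ a, ξ a • w a i))
        (unitVec (v j - ∑ a, ξ a • w a j)) ^ 2 - ∑ i, ∑ j, inner ℝ (e i) (e j) ^ 2| ≤
      150 * (perturbationConst (Fintype.card κ) c L / r) := by
  have hr0 : 0 < r := by linarith
  have hcr : 0 < c * r ^ 2 := by positivity
  have hv0 : ∀ i, 0 < ‖v i‖ := fun i => by
    have := hcr.trans_le (hv i)
    exact norm_pos_iff.2 fun h => by simp [h] at this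
  have hinv : ∀ i, (‖v i‖⁻¹) ^ 2 ≤ (c * r ^ 2)⁻¹ := fun i => by
    rw [inv_pow]
    exact inv_anti₀ hcr (hv i)
  have hinv' : ∀ i, ‖v i‖⁻¹ ≤ (√c * r)⁻¹ := fun i => by
    refine inv_anti₀ (by positivity) (abs_le_of_sq_le_sq' ?_ (norm_nonneg _)).2
    rw [mul_pow, Real.sq_sqrt hc.le]
    exact hv i
  obtain ⟨π, hπ⟩ : ∃ π : ι → E, ∀ i, π i = ‖v i‖⁻¹ • ∑ a, ξ a • w a i := ⟨_, fun _ => rfl⟩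
  set k : ℝ := (Fintype.card κ : ℝ) with hk
  have hunit : ∀ i, unitVec (v i - ∑ a, ξ a • w a i) = unitVec (e i - π i) := fun i => by
    rw [he, hπ, unitVec.eq_def (v i), ← smul_sub, unitVec_smul_pos (inv_pos.2 (hv0 i))]
  simp only [hunit]
  unfold perturbationControl at hW
  obtain ⟨Q, hQ⟩ : ∃ Q, Q = ∑ a, ξ a ^ 2 := ⟨_, rfl⟩
  obtain ⟨H1, hH1⟩ : ∃ H, H = ∑ a, ∑ i, ∑ j ∈ Finset.univ.erase i,
    inner ℝ (e j) (w a i) ^ 2 := ⟨_, rfl⟩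
  obtain ⟨H2, hH2⟩ : ∃ H, H = ∑ a, ∑ i, |∑ j ∈ Finset.univ.erase i,
    inner ℝ (u i) (e j) * inner ℝ (e j) (w a i)| := ⟨_, rfl⟩
  obtain ⟨H3, hH3⟩ : ∃ H, H = ∑ i, ∑ j ∈ Finset.univ.erase i,
    inner ℝ (e i) (e j) ^ 2 := ⟨_, rfl⟩
  obtain ⟨H4, hH4⟩ : ∃ H, H = ∑ a, ∑ i, ‖w a i‖ ^ 2 *
    ∑ j ∈ Finset.univ.erase i, inner ℝ (e i) (e j) ^ 2 := ⟨_, rfl⟩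
  obtain ⟨H5, hH5⟩ : ∃ H, H = ∑ a, ∑ i, |inner ℝ (e i) (w a i)| *
    ∑ j ∈ Finset.univ.erase i, inner ℝ (e i) (e j) ^ 2 := ⟨_, rfl⟩
  rw [← hQ, ← hH1, ← hH2, ← hH3, ← hH4, ← hH5] at hW
  have Q0 : 0 ≤ Q := by rw [hQ]; positivity
  have H10 : 0 ≤ H1 := by rw [hH1]; positivity
  have H20 : 0 ≤ r * H2 := by rw [hH2]; positivity
  have H30 : 0 ≤ (r ^ 2)⁻¹ * H3 := by rw [hH3]; positivity
  have H40 : 0 ≤ H4 := by rw [hH4]; positivity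
  have H50 : 0 ≤ H5 := by rw [hH5]; positivity
  have hsqrtQ : √Q ≤ L := by
    rw [Real.sqrt_le_left (by linarith)]
    nlinarith
  have hξ : ∀ a, |ξ a| ≤ √Q := fun a => by
    rw [← Real.sqrt_sq_eq_abs, hQ]
    exact Real.sqrt_le_sqrt (Finset.single_le_sum (f := fun a => ξ a ^ 2)
      (fun a _ => sq_nonneg _) (Finset.mem_univ a))
  have hr2 : r ≤ r ^ 2 := by nlinarith
  have hπw : ∀ i, ‖π i‖ ^ 2 ≤ (c * r ^ 2)⁻¹ * (Q * ∑ a, ‖w a i‖ ^ 2) := fun i => by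
    rw [hπ, norm_smul, mul_pow, norm_inv, norm_norm]
    rw [hQ]
    exact mul_le_mul (hinv i) (norm_sq_sum_smul_le _ _) (sq_nonneg _) (by positivity)
  have hπsum : ∑ i, ‖π i‖ ^ 2 ≤ L * k / c / r ^ 2 := by
    calc _ ≤ ∑ i, (c * r ^ 2)⁻¹ * (Q * ∑ a, ‖w a i‖ ^ 2) := Finset.sum_le_sum fun i _ => hπw i
      _ = (c * r ^ 2)⁻¹ * (Q * k) := by
          rw [← Finset.mul_sum, ← Finset.mul_sum, Finset.sum_comm]
          simp [hw, hk]
      _ ≤ (c * r ^ 2)⁻¹ * (L * k) := by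
          gcongr
          linarith
      _ = _ := by field_simp
  have b1 : ∑ i, ∑ j ∈ Finset.univ.erase i, inner ℝ (π i) (e j) ^ 2 ≤ L ^ 2 / c / r := by
    have h1 : ∀ i j, inner ℝ (π i) (e j) ^ 2 ≤
        (c * r ^ 2)⁻¹ * (Q * ∑ a, inner ℝ (e j) (w a i) ^ 2) := fun i j => by
      rw [hπ, real_inner_smul_left, mul_pow, sum_inner]
      refine mul_le_mul (hinv i) ?_ (sq_nonneg _) (by positivity)
      simp only [real_inner_comm (e j), real_inner_smul_right]
      rw [hQ]
      exact sq_sum_mul_le _ _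
    calc _ ≤ ∑ i, ∑ j ∈ Finset.univ.erase i,
          (c * r ^ 2)⁻¹ * (Q * ∑ a, inner ℝ (e j) (w a i) ^ 2) :=
          Finset.sum_le_sum fun i _ => Finset.sum_le_sum fun j _ => h1 i j
      _ = (c * r ^ 2)⁻¹ * (Q * H1) := by
          simp only [← Finset.mul_sum]
          rw [hH1, Finset.sum_comm (s := (Finset.univ : Finset κ))]
          congr 2
          exact Finset.sum_congr rfl fun i _ => Finset.sum_comm
      _ ≤ (c * r)⁻¹ * (L * L) := by
          have : Q ≤ L := by linarith
          have : H1 ≤ L := by linarith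
          gcongr
      _ = _ := by field_simp
  have b3 : |∑ i, ∑ j ∈ Finset.univ.erase i, inner ℝ (e i) (e j) * inner ℝ (π i) (e j)| ≤
      L ^ 2 / r := by
    -- The factor `‖v i‖⁻¹` is moved from `π i` to `e i`, which turns `e i` into `u i` and leaves
    -- the fixed vectors `w a i`.
    have h1 : ∀ i j, inner ℝ (e i) (e j) * inner ℝ (π i) (e j) =
        ∑ a, ξ a * (inner ℝ (u i) (e j) * inner ℝ (e j) (w a i)) := fun i j => by
      rw [he i, hu i, hπ i, unitVec]
      simp only [real_inner_smul_left, sum_inner]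
      rw [Finset.mul_sum, Finset.mul_sum]
      refine Finset.sum_congr rfl fun a _ => ?_
      rw [real_inner_comm (e j) (w a i)]
      ring
    have h2 : ∑ i, ∑ j ∈ Finset.univ.erase i, inner ℝ (e i) (e j) * inner ℝ (π i) (e j) =
        ∑ a, ξ a * ∑ i, ∑ j ∈ Finset.univ.erase i,
          inner ℝ (u i) (e j) * inner ℝ (e j) (w a i) := by
      simp only [h1, Finset.mul_sum]
      rw [Finset.sum_comm (s := (Finset.univ : Finset κ))]
      exact Finset.sum_congr rfl fun i _ => Finset.sum_comm
    rw [h2]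
    calc _ ≤ ∑ a, √Q * ∑ i, |∑ j ∈ Finset.univ.erase i,
          inner ℝ (u i) (e j) * inner ℝ (e j) (w a i)| := by
          refine (Finset.abs_sum_le_sum_abs _ _).trans (Finset.sum_le_sum fun a _ => ?_)
          rw [abs_mul]
          exact mul_le_mul (hξ a) (Finset.abs_sum_le_sum_abs _ _) (abs_nonneg _)
            (Real.sqrt_nonneg _)
      _ = √Q * (r * H2) / r := by
          rw [← Finset.mul_sum, ← hH2]
          field_simp
      _ ≤ L * L / r := by
          have : r * H2 ≤ L := by linarith
          gcongr
      _ = _ := by rw [pow_two]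
  have b4 : |∑ i, ∑ j ∈ Finset.univ.erase i, inner ℝ (e i) (e j) * inner ℝ (π i) (π j)| ≤
      (L + (L * k / c) ^ 2) / 2 / r := by
    -- Young's inequality with weight `r ^ 3`: the sum of squared correlations is of order `r ^ 2`
    -- and that of `‖π i‖² ‖π j‖²` of order `r ^ (-4)`, so both parts become of order `1 / r`.
    have h1 : ∀ i j, |inner ℝ (e i) (e j) * inner ℝ (π i) (π j)| ≤
        (r ^ 3)⁻¹ / 2 * inner ℝ (e i) (e j) ^ 2 + r ^ 3 / 2 * (‖π i‖ ^ 2 * ‖π j‖ ^ 2) :=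
      fun i j => by
        have h2 := abs_real_inner_le_norm (π i) (π j)
        have h3 : |inner ℝ (π i) (π j)| ^ 2 ≤ ‖π i‖ ^ 2 * ‖π j‖ ^ 2 := by
          rw [← mul_pow]
          exact pow_le_pow_left₀ (abs_nonneg _) h2 2
        rw [abs_mul]
        generalize |inner ℝ (π i) (π j)| = y at h3
        rw [← sq_abs (inner ℝ (e i) (e j))]
        generalize |inner ℝ (e i) (e j)| = x
        have h4 : 0 < r ^ 3 := by positivity
        have h5 : x * y ≤ (r ^ 3)⁻¹ / 2 * x ^ 2 + r ^ 3 / 2 * y ^ 2 := by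
          have h6 : (r ^ 3)⁻¹ / 2 * x ^ 2 + r ^ 3 / 2 * y ^ 2 - x * y =
              (r ^ 3)⁻¹ / 2 * (x - r ^ 3 * y) ^ 2 := by
            field_simp
            ring
          have : 0 ≤ (r ^ 3)⁻¹ / 2 * (x - r ^ 3 * y) ^ 2 := by positivity
          linarith
        nlinarith
    have h2 : ∑ i, ∑ j ∈ Finset.univ.erase i, ‖π i‖ ^ 2 * ‖π j‖ ^ 2 ≤
        (L * k / c / r ^ 2) ^ 2 := by
      calc _ ≤ ∑ i, ‖π i‖ ^ 2 * ∑ j, ‖π j‖ ^ 2 := by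
            refine Finset.sum_le_sum fun i _ => ?_
            rw [Finset.mul_sum]
            exact Finset.sum_le_sum_of_subset_of_nonneg (Finset.subset_univ _)
              fun j _ _ => by positivity
        _ = (∑ i, ‖π i‖ ^ 2) ^ 2 := by rw [← Finset.sum_mul, pow_two]
        _ ≤ _ := pow_le_pow_left₀ (by positivity) hπsum 2
    calc _ ≤ ∑ i, ∑ j ∈ Finset.univ.erase i,
          ((r ^ 3)⁻¹ / 2 * inner ℝ (e i) (e j) ^ 2 + r ^ 3 / 2 * (‖π i‖ ^ 2 * ‖π j‖ ^ 2)) :=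
          (Finset.abs_sum_le_sum_abs _ _).trans (Finset.sum_le_sum fun i _ =>
            (Finset.abs_sum_le_sum_abs _ _).trans (Finset.sum_le_sum fun j _ => h1 i j))
      _ = ((r ^ 2)⁻¹ * H3) / 2 / r +
          r ^ 3 / 2 * ∑ i, ∑ j ∈ Finset.univ.erase i, ‖π i‖ ^ 2 * ‖π j‖ ^ 2 := by
          simp only [Finset.sum_add_distrib, ← Finset.mul_sum]
          rw [← hH3]
          congr 1
          field_simp
      _ ≤ L / 2 / r + r ^ 3 / 2 * (L * k / c / r ^ 2) ^ 2 := by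
          have : (r ^ 2)⁻¹ * H3 ≤ L := by linarith
          gcongr
      _ = _ := by field_simp
  have b5 : ∑ i, (|inner ℝ (e i) (π i)| + ‖π i‖ ^ 2) *
      ∑ j ∈ Finset.univ.erase i, inner ℝ (e i) (e j) ^ 2 ≤ (L ^ 2 / √c + L ^ 2 / c) / r := by
    have h1 : ∀ i, |inner ℝ (e i) (π i)| ≤
        (√c * r)⁻¹ * (√Q * ∑ a, |inner ℝ (e i) (w a i)|) := fun i => by
      rw [hπ, real_inner_smul_right, abs_mul, abs_of_nonneg (inv_nonneg.2 (norm_nonneg _)),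
        inner_sum]
      refine mul_le_mul (hinv' i) ?_ (abs_nonneg _) (by positivity)
      rw [Finset.mul_sum]
      refine (Finset.abs_sum_le_sum_abs _ _).trans (Finset.sum_le_sum fun a _ => ?_)
      rw [real_inner_smul_right, abs_mul]
      exact mul_le_mul_of_nonneg_right (hξ a) (abs_nonneg _)
    have hc' : 0 < √c := Real.sqrt_pos.2 hc
    calc _ ≤ ∑ i, ((√c * r)⁻¹ * (√Q * ∑ a, |inner ℝ (e i) (w a i)|) +
          (c * r ^ 2)⁻¹ * (Q * ∑ a, ‖w a i‖ ^ 2)) *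
            ∑ j ∈ Finset.univ.erase i, inner ℝ (e i) (e j) ^ 2 :=
          Finset.sum_le_sum fun i _ => mul_le_mul_of_nonneg_right (add_le_add (h1 i) (hπw i))
            (Finset.sum_nonneg fun j _ => sq_nonneg _)
      _ = (√c * r)⁻¹ * (√Q * H5) + (c * r ^ 2)⁻¹ * (Q * H4) := by
          rw [hH5, hH4, Finset.sum_comm (s := (Finset.univ : Finset κ)),
            Finset.sum_comm (s := (Finset.univ : Finset κ))]
          simp only [Finset.mul_sum, Finset.sum_mul, add_mul, Finset.sum_add_distrib, mul_assoc]
          congr 1 <;> exact Finset.sum_congr rfl fun i _ => Finset.sum_comm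
      _ ≤ (√c * r)⁻¹ * (L * L) + (c * r)⁻¹ * (L * L) := by
          have : Q ≤ L := by linarith
          have : H5 ≤ L := by linarith
          have : H4 ≤ L := by linarith
          gcongr
      _ = _ := by field_simp
  have hconst : perturbationConst k c L / r = L ^ 2 / c / r + L * k / c / r + L ^ 2 / r +
      (L + (L * k / c) ^ 2) / 2 / r + (L ^ 2 / √c + L ^ 2 / c) / r := by
    rw [perturbationConst]
    ring
  have c1 : 0 ≤ L ^ 2 / c / r := by positivity
  have c2 : 0 ≤ L * k / c / r := by positivity
  have c3 : 0 ≤ L ^ 2 / r := by positivity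
  have c4 : 0 ≤ (L + (L * k / c) ^ 2) / 2 / r := by positivity
  have c5 : 0 ≤ (L ^ 2 / √c + L ^ 2 / c) / r := by positivity
  have b2 : ∑ i, ‖π i‖ ^ 2 ≤ L * k / c / r := hπsum.trans (by gcongr)
  have he1 : ∀ i, ‖e i‖ = 1 := fun i => by
    rw [he i]
    exact norm_unitVec (norm_pos_iff.1 (hv0 i))
  exact abs_sum_sq_inner_unitVec_sub_le he1 hsmall (by linarith) (by linarith) (by linarith) (by linarith)
    (by linarith)

end Perturbation

/-! ### Probabilistic input for a fixed design. -/

section FixedDesign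

variable {Ω : Type*} [MeasurableSpace Ω] {P : Measure Ω} [IsProbabilityMeasure P]

/-- Convergence in probability from a bound in terms of a control variable with bounded mean, off
an event of vanishing probability. -/
theorem tendstoInMeasure_zero_of_control {f : ℕ → Ω → ℝ} {B : ℕ → Set Ω} {C : ℝ}
    {g : ℝ → ℕ → ℝ} (hB : Tendsto (fun T => P (B T)) atTop (𝓝 0))
    (hg : ∀ L, Tendsto (g L) atTop (𝓝 0))
    (h : ∀ᶠ T in atTop, ∃ W : Ω → ℝ, Integrable W P ∧ (∀ ω, 0 ≤ W ω) ∧ ∫ ω, W ω ∂P ≤ C ∧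
      ∀ L ≥ 1, g L T ≤ 1 / 16 → ∀ ω, ω ∉ B T → W ω ≤ L → |f T ω| ≤ 150 * g L T) :
    TendstoInMeasure P f atTop fun _ => 0 := by
  rw [tendstoInMeasure_iff_norm]
  intro ε hε
  rw [ENNReal.tendsto_nhds_zero]
  intro δ hδ
  have hδ2 : 0 < δ / 2 := ENNReal.half_pos hδ.ne'
  have hC : Tendsto (fun L : ℝ => ENNReal.ofReal (C / L)) atTop (𝓝 0) := by
    simpa using ENNReal.tendsto_ofReal (tendsto_const_nhds.div_atTop tendsto_id (a := C))
  -- By Markov's inequality the control exceeds `L` with probability at most `C / L`, uniformly in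
  -- `T`; so `L` is fixed before `T` grows.
  obtain ⟨L, hLC, hL1⟩ := (((ENNReal.tendsto_nhds_zero.1 hC) _ hδ2).and
    (eventually_ge_atTop (1 : ℝ))).exists
  have hL0 : 0 < L := by linarith
  filter_upwards [h, (ENNReal.tendsto_nhds_zero.1 hB) _ hδ2,
    (hg L).eventually_lt_const (show (0 : ℝ) < 1 / 16 by norm_num),
    (hg L).eventually_lt_const (show (0 : ℝ) < ε / 150 by positivity)] with T hT hBT hg1 hg2
  obtain ⟨W, hWint, hW0, hWC, hWf⟩ := hT
  have hM : P {ω | L ≤ W ω} ≤ δ / 2 := by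
    refine le_trans ?_ hLC
    rw [← ofReal_measureReal]
    apply ENNReal.ofReal_le_ofReal
    rw [le_div_iff₀ hL0, mul_comm]
    exact (mul_meas_ge_le_integral_of_nonneg (ae_of_all _ hW0) hWint L).trans hWC
  calc _ ≤ P (B T ∪ {ω | L ≤ W ω}) := by
        refine measure_mono fun ω hω => ?_
        by_contra hcon
        simp only [Set.mem_union, Set.mem_ofPred_eq, not_or, not_le] at hcon
        have := hWf L hL1 hg1.le ω hcon.1 hcon.2.le
        simp only [Set.mem_ofPred_eq, sub_zero, Real.norm_eq_abs] at hω
        linarith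
    _ ≤ δ / 2 + δ / 2 := (measure_union_le _ _).trans (add_le_add hBT hM)
    _ = δ := ENNReal.add_halves δ

/-- The reciprocal of the square, cut off below the level `c`. -/
noncomputable def cutoffInvSq (c x : ℝ) : ℝ := if c ≤ x ^ 2 then (x ^ 2)⁻¹ else 0

theorem measurable_cutoffInvSq (c : ℝ) : Measurable (cutoffInvSq c) :=
  Measurable.ite (measurableSet_le measurable_const (by fun_prop)) (by fun_prop)
    measurable_const

/-- The cutoff keeps the vector radial, hence isotropic, and makes it bounded. With `c` of order `T`
this yields second moments of order `1/T²` in each direction. -/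
theorem norm_cutoffInvSq_smul_le {E : Type*} [NormedAddCommGroup E] [NormedSpace ℝ E] {c : ℝ}
    (hc : 0 < c) (v : E) : ‖cutoffInvSq c ‖v‖ • v‖ ≤ (√c)⁻¹ := by
  rw [cutoffInvSq]
  split_ifs with h
  · have hv : 0 < ‖v‖ := by
      have := hc.trans_le h
      exact norm_pos_iff.2 fun h => by simp [h] at this
    rw [norm_smul, norm_inv, norm_pow, norm_norm]
    have : (‖v‖ ^ 2)⁻¹ * ‖v‖ = ‖v‖⁻¹ := by field_simp
    rw [this]
    refine inv_anti₀ (Real.sqrt_pos.2 hc) ?_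
    rwa [Real.sqrt_le_left (norm_nonneg _)]
  · simp

theorem ErrorAssumption.isotropicFamily {ν : ℕ → ℕ → Ω → ℝ} (hν : ErrorAssumption P ν)
    (hnull : NullHypothesis P ν) {n T : ℕ} (hT : 1 < T) {c : ℝ} (hc : 0 < c) :
    IsotropicFamily P
      (fun (i : Fin n) ω => unitVec (initialSegment T (centred T fun t => ν i t ω)))
      (fun (i : Fin n) ω => cutoffInvSq c ‖initialSegment T (centred T fun t => ν i t ω)‖ •
        initialSegment T (centred T fun t => ν i t ω))
      ((T : ℝ) - 1)⁻¹ (c⁻¹ * ((T : ℝ) - 1)⁻¹) := by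
  have hT1 : (0 : ℝ) < (T : ℝ) - 1 := by
    have : (1 : ℝ) < T := by exact_mod_cast hT
    linarith
  have hid : ∀ i t, IdentDistrib (ν i t) (ν i 0) P P := fun i t =>
    (hν.identDistrib t).comp (measurable_pi_apply i)
  have hcv := measurable_centredVec T
  have hcut := measurable_cutoffInvSq c
  simp only [initialSegment_centred]
  refine ⟨?_, fun i ω => norm_unitVec_le_one _, fun i => ?_, fun i => ?_, by positivity⟩
  · have h1 : iIndepFun (fun (i : Fin n) (ω : Ω) (t : ℕ) => ν i t ω) P :=
      iIndepFun.precomp (g := fun i : Fin n => (i : ℕ)) Fin.val_injective hnull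
    refine h1.comp (fun (_ : Fin n) (f : ℕ → ℝ) => (unitVec (centredVec fun t : Fin T => f t),
      cutoffInvSq c ‖centredVec fun t : Fin T => f t‖ • centredVec fun t : Fin T => f t))
      fun i => ?_
    have h2 : Measurable fun f : ℕ → ℝ => centredVec fun t : Fin T => f t :=
      hcv.comp (by fun_prop)
    unfold unitVec
    fun_prop
  · obtain ⟨q, hq, h⟩ := isotropicCentred_smul_centredVec (hν.measurable i) (hν.iIndepFun_unit i)
      (hid i) hT (φ := fun x => x⁻¹) (by fun_prop) (b := 1) fun v => norm_unitVec_le_one v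
    exact ⟨q, by simpa using hq, h⟩
  · obtain ⟨q, hq, h⟩ := isotropicCentred_smul_centredVec (hν.measurable i) (hν.iIndepFun_unit i)
      (hid i) hT hcut fun v => norm_cutoffInvSq_smul_le hc v
    refine ⟨q, hq.trans_eq ?_, h⟩
    rw [inv_pow, Real.sq_sqrt hc.le, div_eq_mul_inv]

/-- Linear forms of independent errors. -/
theorem ErrorAssumption.integral_sq_sum_inner_le {ν : ℕ → ℕ → Ω → ℝ} (hν : ErrorAssumption P ν)
    (hnull : NullHypothesis P ν) {K : ℝ} (hK : ∀ i t, ∫ ω, ν i t ω ^ 2 ∂P ≤ K) {n T : ℕ}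
    {w : Fin n → EuclideanSpace ℝ (Fin T)} (hw : ∑ i, ‖w i‖ ^ 2 = 1)
    (hw0 : ∀ i, ∑ t, w i t = 0) :
    Integrable (fun ω => (∑ i : Fin n, inner ℝ (w i)
      (initialSegment T (centred T fun t => ν i t ω))) ^ 2) P ∧
    ∫ ω, (∑ i : Fin n, inner ℝ (w i)
      (initialSegment T (centred T fun t => ν i t ω))) ^ 2 ∂P ≤ K := by
  have h1 : ∀ i : Fin n, ∀ ω, inner ℝ (w i) (initialSegment T (centred T fun t => ν i t ω)) =
      ∑ t : Fin T, w i t * ν i t ω := fun i ω => by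
    rw [inner_eq_sum_mul]
    simp only [initialSegment_apply, centred, mul_sub, Finset.sum_sub_distrib]
    -- As `w i` has coordinate sum zero, the centring drops out and a linear form in independent
    -- errors remains.
    rw [← Finset.sum_mul, hw0, zero_mul, sub_zero]
  simp only [h1]
  have hm : ∀ (i : Fin n) (t : Fin T), MemLp (fun ω => w i t * ν i t ω) 2 P := fun i t =>
    (hν.memLp_two i t).const_mul _
  have hms : ∀ i : Fin n, MemLp (fun ω => ∑ t : Fin T, w i t * ν i t ω) 2 P := fun i =>
    memLp_finsetSum _ fun t _ => hm i t
  have hmt : MemLp (fun ω => ∑ i : Fin n, ∑ t : Fin T, w i t * ν i t ω) 2 P :=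
    memLp_finsetSum _ fun i _ => hms i
  refine ⟨hmt.integrable_sq, ?_⟩
  have hmean : ∫ ω, ∑ i : Fin n, ∑ t : Fin T, w i t * ν i t ω ∂P = 0 := by
    rw [integral_finsetSum _ fun i _ => (hms i).integrable one_le_two]
    refine Finset.sum_eq_zero fun i _ => ?_
    rw [integral_finsetSum _ fun t _ => (hm i t).integrable one_le_two]
    exact Finset.sum_eq_zero fun t _ => by rw [integral_const_mul, hν.mean_zero, mul_zero]
  rw [← variance_of_integral_eq_zero hmt.aemeasurable hmean]
  have hv1 : Var[fun ω => ∑ i : Fin n, ∑ t : Fin T, w i t * ν i t ω; P] =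
      ∑ i : Fin n, Var[fun ω => ∑ t : Fin T, w i t * ν i t ω; P] := by
    have := IndepFun.variance_sum (s := Finset.univ) (μ := P)
      (X := fun (i : Fin n) ω => ∑ t : Fin T, w i t * ν i t ω) (fun i _ => hms i)
      fun i _ j _ hij => by
        have h := iIndepFun.indepFun hnull (i := (i : ℕ)) (j := (j : ℕ))
          (fun h => hij (Fin.ext h))
        exact h.comp (φ := fun f : ℕ → ℝ => ∑ t : Fin T, w i t * f t)
          (ψ := fun f : ℕ → ℝ => ∑ t : Fin T, w j t * f t) (by fun_prop) (by fun_prop)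
    rw [← this]
    congr 1
    ext ω
    simp
  have hv2 : ∀ i : Fin n, Var[fun ω => ∑ t : Fin T, w i t * ν i t ω; P] ≤ K * ‖w i‖ ^ 2 :=
    fun i => by
      have := IndepFun.variance_sum (s := Finset.univ) (μ := P)
        (X := fun (t : Fin T) ω => w i t * ν i t ω) (fun t _ => hm i t)
        fun t _ s _ hts => by
          have h := (hν.iIndepFun_unit i).indepFun (i := (t : ℕ)) (j := (s : ℕ))
            (fun h => hts (Fin.ext h))
          exact h.comp (φ := fun a => w i t * a) (ψ := fun a => w i s * a) (by fun_prop)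
            (by fun_prop)
      have h2 : (fun ω => ∑ t : Fin T, w i t * ν i t ω) =
          ∑ t : Fin T, fun ω => w i t * ν i t ω := by
        ext ω
        simp
      rw [h2, this, EuclideanSpace.norm_sq_eq, Finset.mul_sum]
      refine Finset.sum_le_sum fun t _ => ?_
      rw [variance_const_mul, variance_of_integral_eq_zero (hν.measurable i t).aemeasurable
        (hν.mean_zero i t), Real.norm_eq_abs, sq_abs, mul_comm]
      exact mul_le_mul_of_nonneg_right (hK i t) (sq_nonneg _)
  rw [hv1]
  refine (Finset.sum_le_sum fun i _ => hv2 i).trans ?_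
  rw [← Finset.mul_sum, hw, mul_one]

end FixedDesign

/-! ### The limit for a fixed design. -/

section FixedDesignLimit

variable {Ω : Type*} [MeasurableSpace Ω] {P : Measure Ω} [IsProbabilityMeasure P]

/-- For `ρ` of order `1/T`, `p` of order `1/T²`, a number of units of order `T` and `r = √T`, each
summand on the right is bounded; this fixes the powers of `r` in `perturbationControl`. -/
theorem IsotropicFamily.integral_perturbationControl_le {τ ι κ : Type*} [Fintype τ]
    [DecidableEq τ] [Fintype ι] [DecidableEq ι] [Fintype κ] {e u : ι → Ω → EuclideanSpace ℝ τ}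
    {ρ p : ℝ} (h : IsotropicFamily P e u ρ p) (hp : 0 ≤ p) {w : κ → ι → EuclideanSpace ℝ τ}
    (hw : ∀ a, ∑ i, ‖w a i‖ ^ 2 = 1) (hw0 : ∀ a i, ∑ t, w a i t = 0) {ξ : κ → Ω → ℝ} {K r : ℝ}
    (hr : 0 ≤ r) (hξ : ∀ a, Integrable (fun ω => ξ a ω ^ 2) P)
    (hξK : ∀ a, ∫ ω, ξ a ω ^ 2 ∂P ≤ K) :
    Integrable (fun ω =>
        perturbationControl r w (fun i => e i ω) (fun i => u i ω) fun a => ξ a ω) P ∧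
      ∫ ω, perturbationControl r w (fun i => e i ω) (fun i => u i ω) (fun a => ξ a ω) ∂P ≤
        Fintype.card κ * K + Fintype.card κ * (Fintype.card ι * ρ)
          + r * (Fintype.card κ *
            (√(p * (Fintype.card ι * ρ + (Fintype.card ι * ρ) ^ 2)) * √(Fintype.card ι)))
          + (r ^ 2)⁻¹ * (Fintype.card ι * (Fintype.card ι * ρ))
          + Fintype.card κ * (Fintype.card ι * ρ)
          + Fintype.card κ * (Fintype.card ι * ρ * √(Fintype.card ι * ρ)) := by
  have sum_le : ∀ {f : κ → Ω → ℝ} {b : ℝ}, (∀ a, Integrable (f a) P) →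
      (∀ a, ∫ ω, f a ω ∂P ≤ b) → ∫ ω, ∑ a, f a ω ∂P ≤ Fintype.card κ * b := fun {f b} hf hb => by
    rw [integral_finsetSum _ fun a _ => hf a]
    refine (Finset.sum_le_sum fun a _ => hb a).trans ?_
    rw [Finset.sum_const, nsmul_eq_mul, Finset.card_univ]
  have i2 : ∀ a, Integrable (fun ω => ∑ i, ∑ j ∈ Finset.univ.erase i,
      inner ℝ (e j ω) (w a i) ^ 2) P := fun a =>
    (BddMeasurable.sum _ fun i _ => BddMeasurable.sum _ fun j _ =>
      ((h.bdd_left j).inner (BddMeasurable.const _)).sq).integrable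
  have i3 : ∀ a, Integrable (fun ω => ∑ i, |∑ j ∈ Finset.univ.erase i,
      inner ℝ (u i ω) (e j ω) * inner ℝ (e j ω) (w a i)|) P := fun a =>
    (BddMeasurable.sum _ fun i _ => (h.bdd_sum_inner_mul_inner i (w a i)).abs).integrable
  have i4 : Integrable (fun ω => ∑ i, ∑ j ∈ Finset.univ.erase i,
      inner ℝ (e i ω) (e j ω) ^ 2) P :=
    (BddMeasurable.sum _ fun i _ => h.bdd_sum_inner_sq i).integrable
  have i5 : ∀ a, Integrable (fun ω => ∑ i, ‖w a i‖ ^ 2 * ∑ j ∈ Finset.univ.erase i,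
      inner ℝ (e i ω) (e j ω) ^ 2) P := fun a =>
    (BddMeasurable.sum _ fun i _ => (BddMeasurable.const _).mul (h.bdd_sum_inner_sq i)).integrable
  have i6 : ∀ a, Integrable (fun ω => ∑ i, |inner ℝ (e i ω) (w a i)| *
      ∑ j ∈ Finset.univ.erase i, inner ℝ (e i ω) (e j ω) ^ 2) P := fun a =>
    (BddMeasurable.sum _ fun i _ => ((h.bdd_left i).inner (BddMeasurable.const _)).abs.mul
      (h.bdd_sum_inner_sq i)).integrable
  have s1 := integrable_finsetSum Finset.univ fun a _ => hξ a
  have s2 := integrable_finsetSum Finset.univ fun a _ => i2 a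
  have s3 := (integrable_finsetSum Finset.univ fun a _ => i3 a).const_mul r
  have s4 := i4.const_mul (r ^ 2)⁻¹
  have s5 := integrable_finsetSum Finset.univ fun a _ => i5 a
  have s6 := integrable_finsetSum Finset.univ fun a _ => i6 a
  have t2 := s1.add s2
  have t3 := t2.add s3
  have t4 := t3.add s4
  have t5 := t4.add s5
  refine ⟨t5.add s6, ?_⟩
  have split := integral_add' t5 s6
  rw [integral_add' t4 s5, integral_add' t3 s4, integral_add' t2 s3, integral_add' s1 s2,
    integral_const_mul, integral_const_mul] at split
  refine split.trans_le ?_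
  gcongr
  · exact sum_le hξ hξK
  · exact sum_le i2 fun a => h.integral_sum_inner_const_sq_le (hw a) (hw0 a)
  · exact sum_le i3 fun a => h.integral_sum_abs_sum_inner_mul_inner_le hp (hw a) (hw0 a)
  · exact h.integral_sum_sum_inner_sq_le
  · exact sum_le i5 fun a => h.integral_sum_norm_sq_mul_sum_inner_sq_le (hw a)
  · exact sum_le i6 fun a => h.integral_sum_abs_inner_mul_sum_inner_sq_le (hw a) (hw0 a)

theorem perturbationControl_nonneg {E ι κ : Type*} [NormedAddCommGroup E]
    [InnerProductSpace ℝ E] [Fintype ι] [DecidableEq ι] [Fintype κ] {r : ℝ} (hr : 0 ≤ r)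
    (w : κ → ι → E) (e u : ι → E) (ξ : κ → ℝ) : 0 ≤ perturbationControl r w e u ξ := by
  unfold perturbationControl
  positivity

/-- The difference of the two traces, as a function of regressors and errors. -/
noncomputable def traceDiff {k : ℕ} (n T : ℕ) (x : ℕ → ℕ → Fin k → ℝ) (ν : ℕ → ℕ → ℝ) : ℝ :=
  (residualCorr n T x ν ^ 2).trace - (errorCorr n T ν ^ 2).trace

/-- With `n ≤ C T` units, the bound for the mean of the control is uniform in `T`. -/
theorem control_bound_le {n T : ℕ} (hT : 1 < T) {C κ k K : ℝ} (hC : 0 ≤ C) (hk : 0 ≤ k)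
    (hκ : 0 < κ) (hn : (n : ℝ) ≤ C * T) :
    k * K + k * (n * ((T : ℝ) - 1)⁻¹)
          + √T * (k * (√((κ * T)⁻¹ * ((T : ℝ) - 1)⁻¹ * (n * ((T : ℝ) - 1)⁻¹ +
            (n * ((T : ℝ) - 1)⁻¹) ^ 2)) * √n))
          + (√T ^ 2)⁻¹ * (n * (n * ((T : ℝ) - 1)⁻¹))
          + k * (n * ((T : ℝ) - 1)⁻¹)
          + k * (n * ((T : ℝ) - 1)⁻¹ * √(n * ((T : ℝ) - 1)⁻¹)) ≤
      k * K + k * (2 * C) + k * √(2 * C / κ * (2 * C + (2 * C) ^ 2)) + C * (2 * C) + k * (2 * C)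
        + k * (2 * C * √(2 * C)) := by
  have hT2 : (2 : ℝ) ≤ T := by exact_mod_cast hT
  have hT1 : (0 : ℝ) < (T : ℝ) - 1 := by linarith
  -- Here `T ≤ 2 (T - 1)` is used.
  have hD : n * ((T : ℝ) - 1)⁻¹ ≤ 2 * C := by
    rw [← div_eq_mul_inv, div_le_iff₀ hT1]
    nlinarith
  have hD0 : 0 ≤ n * ((T : ℝ) - 1)⁻¹ := by positivity
  have h3 : √T * (k * (√((κ * T)⁻¹ * ((T : ℝ) - 1)⁻¹ * (n * ((T : ℝ) - 1)⁻¹ +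
      (n * ((T : ℝ) - 1)⁻¹) ^ 2)) * √n)) ≤ k * √(2 * C / κ * (2 * C + (2 * C) ^ 2)) := by
    have e : √T * (k * (√((κ * T)⁻¹ * ((T : ℝ) - 1)⁻¹ * (n * ((T : ℝ) - 1)⁻¹ +
        (n * ((T : ℝ) - 1)⁻¹) ^ 2)) * √n)) =
        k * √(n * ((T : ℝ) - 1)⁻¹ / κ * (n * ((T : ℝ) - 1)⁻¹ + (n * ((T : ℝ) - 1)⁻¹) ^ 2)) := by
      rw [mul_left_comm, ← mul_assoc, ← mul_assoc, mul_assoc k, ← Real.sqrt_mul (by positivity),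
        mul_assoc k, ← Real.sqrt_mul (by positivity)]
      congr 2
      field_simp
    rw [e]
    gcongr
  have h4 : (√T ^ 2)⁻¹ * (n * (n * ((T : ℝ) - 1)⁻¹)) ≤ C * (2 * C) := by
    rw [Real.sq_sqrt (by positivity), ← mul_assoc]
    have : (T : ℝ)⁻¹ * n ≤ C := by
      rw [inv_mul_le_iff₀ (by positivity)]
      linarith
    gcongr
  gcongr

/-- For non-random regressors the residual and the error trace have the same limit. -/
theorem ErrorAssumption.tendstoInMeasure_traceDiff {ν : ℕ → ℕ → Ω → ℝ}
    (hν : ErrorAssumption P ν) (hnull : NullHypothesis P ν)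
    (hvar : ∃ σ₀ > 0, ∀ i t, σ₀ ≤ Var[ν i t; P]) {k : ℕ} {n : ℕ → ℕ} {c : ℝ}
    (hn : Tendsto (fun T : ℕ => (n T : ℝ) / (T : ℝ)) atTop (𝓝 c)) (x : ℕ → ℕ → Fin k → ℝ)
    (hG : ∀ᶠ T : ℕ in atTop, IsUnit (pooledGram (n T) T x)) :
    TendstoInMeasure P (fun T ω => traceDiff (n T) T x fun i t => ν i t ω) atTop fun _ => 0 := by
  obtain ⟨κ, hκ, hB⟩ := hν.exists_tendsto_measure_norm_sq_lt hvar hn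
  obtain ⟨K, -, hK⟩ := hν.exists_moment_le
  have hc : 0 ≤ c := ge_of_tendsto' hn fun T => by positivity
  refine tendstoInMeasure_zero_of_control hB
    (g := fun L T => perturbationConst k κ L / √T)
    (C := k * K + k * (2 * (c + 1)) + k * √(2 * (c + 1) / κ * (2 * (c + 1) + (2 * (c + 1)) ^ 2))
      + (c + 1) * (2 * (c + 1)) + k * (2 * (c + 1)) + k * (2 * (c + 1) * √(2 * (c + 1))))
    (fun L => tendsto_const_nhds.div_atTop
      (Real.tendsto_sqrt_atTop.comp tendsto_natCast_atTop_atTop)) ?_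
  filter_upwards [hG, eventually_gt_atTop 1, hn.eventually_lt_const (lt_add_one c)]
    with T hGT hT hnT
  have hT0 : 0 < T := by omega
  have hT0' : (0 : ℝ) < T := by exact_mod_cast hT0
  have hnT' : (n T : ℝ) ≤ (c + 1) * T := by
    rw [div_lt_iff₀ hT0'] at hnT
    exact hnT.le
  have hT1 : (0 : ℝ) < (T : ℝ) - 1 := by
    have : (1 : ℝ) < T := by exact_mod_cast hT
    linarith
  obtain ⟨w, hw0, hw, hres⟩ := exists_initialSegment_olsResidual_eq hT0 x hGT
  -- The cutoff level is the threshold of the bad event, so off that event `u i` is exactly `v i /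
  -- ‖v i‖²`.
  have hfam := hν.isotropicFamily hnull (n := n T) hT (c := κ * T) (by positivity)
  have hξ := fun a => hν.integral_sq_sum_inner_le hnull (fun i t => (hK i t).1) (hw a) (hw0 a)
  obtain ⟨hint, hle⟩ := hfam.integral_perturbationControl_le (by positivity) hw hw0
    (Real.sqrt_nonneg T) (fun a => (hξ a).1) (fun a => (hξ a).2)
  refine ⟨_, hint, fun ω => perturbationControl_nonneg (Real.sqrt_nonneg _) _ _ _ _, ?_, ?_⟩
  · refine hle.trans ?_
    simp only [Fintype.card_fin]
    exact control_bound_le hT (by positivity) (by positivity) hκ hnT'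
  · intro L hL hsmall ω hω hW
    simp only [not_exists, not_lt] at hω
    have hmain := abs_sum_sq_inner_unitVec_sub_sum_smul_le (r := √T)
      (by rw [Real.one_le_sqrt]; exact_mod_cast hT.le) hκ hL (fun i => rfl)
      (fun i => by rw [cutoffInvSq, if_pos (hω i)])
      (by rw [Real.sq_sqrt hT0'.le]; exact hω) hw hW (by rwa [Fintype.card_fin])
    rw [Fintype.card_fin] at hmain
    rw [traceDiff, residualCorr, errorCorr, trace_sq_corrOfCov_sampleCov hT0,
      trace_sq_corrOfCov_sampleCov hT0]
    -- `traceDiff` takes the errors themselves as responses, a panel with zero intercept, slope and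
    -- effects.
    have := hres (fun i t => ν i t ω) (fun i t => ν i t ω) 0 0 0 (by simp)
    simp only [this]
    exact hmain

end FixedDesignLimit

/-! ### Measurability and the passage to random regressors. -/

section RandomDesign

theorem continuous_pooledGram {k : ℕ} (n T : ℕ) :
    Continuous fun x : ℕ → ℕ → Fin k → ℝ => pooledGram n T x := by
  unfold pooledGram design centred
  refine continuous_finsetSum _ fun i _ => ?_
  have : Continuous fun x : ℕ → ℕ → Fin k → ℝ => (Matrix.of fun (a : Fin k) (t : Fin T) =>
      (x i t - (T : ℝ)⁻¹ • ∑ s ∈ Finset.range T, x i s) a) :=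
    continuous_matrix fun a t => by
      simp only [Matrix.of_apply, Pi.sub_apply, Pi.smul_apply, Finset.sum_apply]
      fun_prop
  exact this.matrix_mul this.matrix_transpose

/-- Cramer's rule: the adjugate and the determinant are continuous in the regressors, and real
inversion, with value `0` at `0`, is measurable. -/
theorem measurable_pooledGram_inv_apply {k : ℕ} (n T : ℕ) (a b : Fin k) :
    Measurable fun x : ℕ → ℕ → Fin k → ℝ => (pooledGram n T x)⁻¹ a b := by
  have h := continuous_pooledGram (k := k) n T
  simp only [Matrix.inv_def, Matrix.smul_apply, smul_eq_mul, Ring.inverse_eq_inv']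
  exact (h.matrix_det.measurable.inv).mul (h.matrix_adjugate.matrix_elem a b).measurable

theorem measurable_olsResidual {k : ℕ} (n T : ℕ) (i t : ℕ) :
    Measurable fun p : (ℕ → ℕ → Fin k → ℝ) × (ℕ → ℕ → ℝ) => olsResidual n T p.1 p.2 i t := by
  have hy : ∀ i t, Measurable fun p : (ℕ → ℕ → Fin k → ℝ) × (ℕ → ℕ → ℝ) =>
      centred T (p.2 i) t := fun i t => by
    unfold centred
    fun_prop
  have hx : ∀ i t a, Measurable fun p : (ℕ → ℕ → Fin k → ℝ) × (ℕ → ℕ → ℝ) =>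
      centred T (p.1 i) t a := fun i t a => by
    simp only [centred]
    fun_prop
  have hinv : ∀ a b, Measurable fun p : (ℕ → ℕ → Fin k → ℝ) × (ℕ → ℕ → ℝ) =>
      (pooledGram n T p.1)⁻¹ a b := fun a b =>
    (measurable_pooledGram_inv_apply n T a b).comp measurable_fst
  have hz : ∀ b, Measurable fun p : (ℕ → ℕ → Fin k → ℝ) × (ℕ → ℕ → ℝ) =>
      (∑ i : Fin n, design T (p.1 i) *ᵥ fun t : Fin T => centred T (p.2 i) t) b := fun b => by
    simp only [Finset.sum_apply, Matrix.mulVec, dotProduct, design, Matrix.of_apply]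
    exact Finset.measurable_fun_sum _ fun i _ => Finset.measurable_fun_sum _ fun t _ =>
      (hx i t b).mul (hy i t)
  have hols : ∀ a, Measurable fun p : (ℕ → ℕ → Fin k → ℝ) × (ℕ → ℕ → ℝ) =>
      olsEstimator n T p.1 p.2 a := fun a => by
    change Measurable fun p : (ℕ → ℕ → Fin k → ℝ) × (ℕ → ℕ → ℝ) => ∑ b,
      (pooledGram n T p.1)⁻¹ a b *
        (∑ i : Fin n, design T (p.1 i) *ᵥ fun t : Fin T => centred T (p.2 i) t) b
    exact Finset.measurable_fun_sum Finset.univ fun b _ => (hinv a b).mul (hz b)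
  exact (hy i t).sub (Finset.measurable_fun_sum _ fun a _ => (hx i t a).mul (hols a))

theorem measurable_trace_sq_corrOfCov {α : Type*} [MeasurableSpace α] {n : ℕ}
    {S : α → Matrix (Fin n) (Fin n) ℝ} (hS : ∀ i j, Measurable fun p => S p i j) :
    Measurable fun p => (corrOfCov (S p) ^ 2).trace := by
  simp only [Matrix.trace, Matrix.diag, pow_two, Matrix.mul_apply, corrOfCov_apply]
  fun_prop

theorem measurable_traceDiff {k : ℕ} (n T : ℕ) :
    Measurable fun p : (ℕ → ℕ → Fin k → ℝ) × (ℕ → ℕ → ℝ) => traceDiff n T p.1 p.2 := by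
  unfold traceDiff residualCorr errorCorr
  refine (measurable_trace_sq_corrOfCov fun i j => ?_).sub
    (measurable_trace_sq_corrOfCov fun i j => ?_)
  · have := measurable_olsResidual (k := k) n T
    simp only [sampleCov, Matrix.of_apply]
    fun_prop
  · simp only [sampleCov, Matrix.of_apply, centred]
    fun_prop

variable {Ω : Type*} [MeasurableSpace Ω] {P : Measure Ω} [IsProbabilityMeasure P]

/-- Convergence in probability given almost every value of an independent variable implies
unconditional convergence in probability. -/
theorem tendstoInMeasure_of_indepFun {α β : Type*} [MeasurableSpace α] [MeasurableSpace β]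
    {X : Ω → α} {Y : Ω → β} (hX : Measurable X) (hY : Measurable Y) (hind : IndepFun X Y P)
    {f : ℕ → α → β → ℝ} (hf : ∀ T, Measurable fun p : α × β => f T p.1 p.2)
    (h : ∀ᵐ ω ∂P, TendstoInMeasure P (fun T ω' => f T (X ω) (Y ω')) atTop fun _ => 0) :
    TendstoInMeasure P (fun T ω => f T (X ω) (Y ω)) atTop fun _ => 0 := by
  rw [tendstoInMeasure_iff_norm]
  intro ε hε
  have := Measure.isProbabilityMeasure_map (μ := P) hX.aemeasurable
  have := Measure.isProbabilityMeasure_map (μ := P) hY.aemeasurable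
  set S : ℕ → Set (α × β) := fun T => {p | ε ≤ ‖f T p.1 p.2 - 0‖} with hS
  have hSm : ∀ T, MeasurableSet (S T) := fun T =>
    measurableSet_le measurable_const ((hf T).sub measurable_const).norm
  have key : ∀ T, P {ω | ε ≤ ‖f T (X ω) (Y ω) - 0‖} =
      ∫⁻ ω, P.map Y (Prod.mk (X ω) ⁻¹' S T) ∂P := fun T => by
    calc _ = P.map (fun ω => (X ω, Y ω)) (S T) :=
          (Measure.map_apply (hX.prodMk hY) (hSm T)).symm
      _ = ((P.map X).prod (P.map Y)) (S T) := by
          rw [(indepFun_iff_map_prod_eq_prod_map_map hX.aemeasurable hY.aemeasurable).1 hind]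
      _ = ∫⁻ a, P.map Y (Prod.mk a ⁻¹' S T) ∂P.map X := Measure.prod_apply (hSm T)
      _ = _ := lintegral_map (measurable_measure_prodMk_left (hSm T)) hX
  simp only [key]
  -- By Fubini the probability is the mean of conditional probabilities, which are at most one and
  -- tend to zero almost surely.
  have hlim := tendsto_lintegral_of_dominated_convergence (μ := P)
    (F := fun T ω => P.map Y (Prod.mk (X ω) ⁻¹' S T)) (f := fun _ => 0) (fun _ => 1)
    (fun T => (measurable_measure_prodMk_left (hSm T)).comp hX)
    (fun T => ae_of_all _ fun ω => prob_le_one) (by simp) ?_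
  · simpa using hlim
  · filter_upwards [h] with ω hω
    rw [tendstoInMeasure_iff_norm] at hω
    refine (hω ε hε).congr fun T => ?_
    rw [Measure.map_apply hY (measurable_prodMk_left (hSm T))]
    rfl

theorem tendsto_measure_compl_of_eventually {A : ℕ → Set Ω} (hA : ∀ T, MeasurableSet (A T))
    (h : ∀ᵐ ω ∂P, ∀ᶠ T in atTop, ω ∈ A T) : Tendsto (fun T => P (A T)ᶜ) atTop (𝓝 0) := by
  have := tendsto_measure_of_ae_tendsto_indicator_of_isFiniteMeasure (μ := P) atTop
    (A := (∅ : Set Ω)) (As := fun T => (A T)ᶜ) MeasurableSet.empty (fun T => (hA T).compl) (by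
      filter_upwards [h] with ω hω
      filter_upwards [hω] with T hT
      simp [hT])
  simpa using this

/-- When the Gram matrix is invertible the residuals are a function of regressors and errors alone,
so the responses may be replaced by the errors. -/
theorem residualCorr_eq_of_panel {k n T : ℕ} (hT : 0 < T) {x : ℕ → ℕ → Fin k → ℝ}
    (hG : IsUnit (pooledGram n T x)) {y ν : ℕ → ℕ → ℝ} {α : ℝ} {β : Fin k → ℝ} {μ : ℕ → ℝ}
    (hy : ∀ i t, y i t = α + x i t ⬝ᵥ β + μ i + ν i t) :
    residualCorr n T x y = residualCorr n T x ν := by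
  obtain ⟨w, -, -, hw⟩ := exists_initialSegment_olsResidual_eq hT x hG
  ext i j
  rw [residualCorr, residualCorr, corrOfCov_sampleCov_apply hT, corrOfCov_sampleCov_apply hT]
  have h1 := hw y ν α β μ hy
  have h2 := hw ν ν 0 0 0 (by simp)
  simp only [h1, h2]

end RandomDesign

end PanelLM

/-! ### The theorem. -/

theorem mainTheorem3 {Ω : Type*} [MeasurableSpace Ω] (P : Measure Ω) [IsProbabilityMeasure P]
    (k : ℕ) (n : ℕ → ℕ) (c : ℝ) (hc : 0 < c)
    -- the simultaneous limit scheme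
    (hn : Tendsto (fun T : ℕ => (n T : ℝ) / (T : ℝ)) atTop (𝓝 c))
    (x : ℕ → ℕ → Ω → Fin k → ℝ) (ν y : ℕ → ℕ → Ω → ℝ)
    -- the fixed effects panel model, `μ i` being the effect of unit `i`
    (α : ℝ) (β : Fin k → ℝ) (μ : ℕ → Ω → ℝ)
    (hy : ∀ i t ω, y i t ω = α + x i t ω ⬝ᵥ β + μ i ω + ν i t ω)
    (hν : PanelLM.ErrorAssumption P ν)
    -- the error variances are bounded away from zero
    (hvar : ∃ σ₀ > 0, ∀ i t, σ₀ ≤ Var[ν i t; P])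
    (hnull : PanelLM.NullHypothesis P ν)
    (hx : PanelLM.RegressorAssumption P n x ν)
    -- the OLS estimator exists
    (hols : ∀ᵐ ω ∂P, ∀ᶠ T : ℕ in atTop, IsUnit (PanelLM.pooledGram (n T) T fun i t => x i t ω)) :
    TendstoInMeasure P
      (fun T ω =>
        (PanelLM.residualCorr (n T) T (fun i t => x i t ω) (fun i t => y i t ω) ^ 2).trace -
          (PanelLM.errorCorr (n T) T (fun i t => ν i t ω) ^ 2).trace)
      atTop (fun _ => 0) := by
  have hX : Measurable fun ω i t => x i t ω :=
    measurable_pi_lambda _ fun i => measurable_pi_lambda _ fun t => hx.measurable i t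
  have hN : Measurable fun ω i t => ν i t ω :=
    measurable_pi_lambda _ fun i => measurable_pi_lambda _ fun t => hν.measurable i t
  have hlim : TendstoInMeasure P
      (fun T ω => PanelLM.traceDiff (n T) T (fun i t => x i t ω) fun i t => ν i t ω) atTop
      fun _ => 0 :=
    PanelLM.tendstoInMeasure_of_indepFun (f := fun T => PanelLM.traceDiff (n T) T) hX hN hx.indep
      (fun T => PanelLM.measurable_traceDiff (n T) T) (by
        filter_upwards [hols] with ω hω
        exact hν.tendstoInMeasure_traceDiff hnull hvar hn _ hω)
  have hA := PanelLM.tendsto_measure_compl_of_eventually (P := P)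
    (A := fun T => {ω | IsUnit (PanelLM.pooledGram (n T) T fun i t => x i t ω)}) (fun T => by
      simp only [Matrix.isUnit_iff_isUnit_det, isUnit_iff_ne_zero]
      exact ((PanelLM.continuous_pooledGram (n T) T).matrix_det.measurable.comp hX)
        (measurableSet_singleton (0 : ℝ)).compl) hols
  rw [tendstoInMeasure_iff_norm] at hlim ⊢
  intro ε hε
  have hsum := hA.add (hlim ε hε)
  rw [add_zero] at hsum
  refine tendsto_of_tendsto_of_tendsto_of_le_of_le' tendsto_const_nhds hsum
    (Eventually.of_forall fun _ => zero_le) ?_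
  filter_upwards [eventually_gt_atTop 0] with T hT
  refine (measure_mono fun ω hω => ?_).trans (measure_union_le _ _)
  -- Replacing `y` by `ν` is justified only where the Gram matrix is invertible; the complement is
  -- absorbed by `hA`.
  by_cases hG : IsUnit (PanelLM.pooledGram (n T) T fun i t => x i t ω)
  · right
    have := PanelLM.residualCorr_eq_of_panel hT hG (y := fun i t => y i t ω)
      (ν := fun i t => ν i t ω) (α := α) (β := β) (μ := fun i => μ i ω) fun i t => hy i t ω
    simpa only [Set.mem_ofPred_eq, PanelLM.traceDiff, this] using hω
  · exact Or.inl hG
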